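/- Let $\mathbf{B}$ be the first-order theory in the language $\{\in\}$ (with equality) whose axioms are Extensionality, Pair, Union, Infinity (there is a limit ordinal), Separation for $\Delta_0$ formulas, Regularity (every nonempty set has an $\in$-minimal element), Transitive Closure (every set has a transitive closure) and Finite Powerset (for every set $x$ the set of finite subsets of $x$ exists). Let $\mathbf{C}$ be $\mathbf{B}$ together with Axiom Beta: for every well founded relation $R$ on a set $X$ there are a transitive set $Y$ and a function $\pi : X \to Y$ such that $\pi(u)=\{\pi(v) : v\in X,\ \langle v,u\rangle\in R\}$ for all $u\in X$. Formulas of set theory, with variables $x_i$ ($i\in\omega$) and built from atomic formulas $x_i\in x_j$, $x_i=x_j$ by $\neg,\wedge,\vee,\exists x_i,\forall x_i$, are coded in set theory by sets in the usual way: numerals serve as tags, and compound formulas are tagged tuples of their components. **Theorem.** $\mathbf{C}$ proves (equivalently, by Gödel's completeness theorem, every model of $\mathbf{C}$ satisfies) that for every set $a$ the elementary diagram $Th(a,\in)$ exists. That is, $\mathbf{C}$ proves that the set $Form$ of all codes of formulas exists, and that for every set $a$ there is exactly one set $H$ such that every element of $H$ is a pair $\langle\theta,\sigma\rangle$, where $\theta\in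 Form$ and $\sigma\in a^{<\omega}$ is a finite sequence whose length $|\sigma|$ exceeds the index of every free variable of $\theta$, and such that, for all $\sigma \in a^{<\omega}$ and whenever the formula on the left is in $Form$ and $|\sigma|$ exceeds the indices of all its free variables: 1. $\langle x_i\in x_j,\sigma\rangle\in H \leftrightarrow \sigma(i)\in\sigma(j)$; 2. $\langle x_i= x_j,\sigma\rangle\in H \leftrightarrow \sigma(i)=\sigma(j)$; 3. $\langle \theta\wedge\psi,\sigma\rangle\in H \leftrightarrow \langle\theta,\sigma\rangle\in H$ and $\langle\psi,\sigma\rangle\in H$; 4. $\langle \theta\vee\psi,\sigma\rangle\in H \leftrightarrow \langle\theta,\sigma\rangle\in H$ or $\langle\psi,\sigma\rangle\in H$; 5. $\langle \neg\theta,\sigma\rangle\in H \leftrightarrow \langle\theta,\sigma\rangle\notin H$; 6. $\langle \exists x_i\,\theta,\sigma\rangle\in H \leftrightarrow \langle\theta,\sigma[b/x_i]\rangle\in H$ for some $b\in a$; 7. $\langle \forall x_i\,\theta,\sigma\rangle\in H \leftrightarrow \langle\theta,\sigma[b/x_i]\rangle\in H$ for all $b\in a$. Here $\sigma[b/x_i]$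 is obtained from $\sigma$ by replacing the value at $i$ by $b$ if $i<|\sigma|$, and by extending $\sigma$ with the value $b$ at all $j$ with $|\sigma|\le j\le i$ otherwise. -/

import Mathlib

open FirstOrder

/-! # The set theories `B` and `C`, and elementary diagrams, as first-order formulas -/

namespace WeakSet

/-! ## The first-order language of set theory -/

/-- The only non-logical symbol: the binary relation symbol `∈`. -/
inductive SetRel : ℕ → Type
  | mem : SetRel 2

/-- The language of set theory `{∈}` (equality is logical). -/
def setLang : FirstOrder.Language.{0, 0} := ⟨fun _ => Empty, SetRel⟩

/-- The symbol `∈`, as a relation symbol of the language. -/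
def memSym : setLang.Relations 2 := SetRel.mem

/-- Formulas of set theory whose free variables are `x₀, …, x_{n-1}`. -/
abbrev SF (n : ℕ) : Type := setLang.BoundedFormula Empty n

/-- The atomic formula `s ∈ t` (for arbitrary terms). -/
def memT {α : Type} {n : ℕ} (s t : setLang.Term (α ⊕ Fin n)) : setLang.BoundedFormula α n :=
  memSym.boundedFormula₂ s t

/-- The atomic formula `x ∈ y`. -/
def memF {n : ℕ} (x y : Fin n) : SF n := memT (&x) (&y)

/-- The atomic formula `x = y`. -/
def eqF {n : ℕ} (x y : Fin n) : SF n := FirstOrder.Language.Term.bdEqual (&x) (&y)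

/- `x ∈' y` and `x ≐ y` are atomic formulas between variables; `x↟` is the variable `x`, seen as a
variable below one more quantifier. -/
infix:75 " ∈' " => memF
infix:75 " ≐ " => eqF
postfix:max "↟" => Fin.castSucc

/-- `∀ x, f x`, where `x` is a new variable. -/
def allF {n : ℕ} (f : Fin (n + 1) → SF (n + 1)) : SF n := (f (Fin.last n)).all

/-- `∃ x, f x`, where `x` is a new variable. -/
def exF {n : ℕ} (f : Fin (n + 1) → SF (n + 1)) : SF n := (f (Fin.last n)).ex

/-- `Δ₀` formulas: built from atomic formulas by propositional connectives (all of which are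
abbreviations in terms of `⊥` and `→`) and the bounded quantifiers `∀ x ∈ v` and `∃ x ∈ v`, where
`v` is a variable other than `x`. -/
inductive IsDelta0 {α : Type} : {n : ℕ} → setLang.BoundedFormula α n → Prop
  | falsum {n : ℕ} : IsDelta0 (FirstOrder.Language.BoundedFormula.falsum (n := n))
  | equal {n : ℕ} (s t : setLang.Term (α ⊕ Fin n)) :
      IsDelta0 (FirstOrder.Language.BoundedFormula.equal s t)
  | mem {n : ℕ} (s t : setLang.Term (α ⊕ Fin n)) : IsDelta0 (memT s t)
  | imp {n : ℕ} {φ ψ : setLang.BoundedFormula α n} :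
      IsDelta0 φ → IsDelta0 ψ → IsDelta0 (φ.imp ψ)
  | ball {n : ℕ} {φ : setLang.BoundedFormula α (n + 1)} (v : α ⊕ Fin n) : IsDelta0 φ →
      IsDelta0 ((memT (&(Fin.last n))
        (FirstOrder.Language.Term.var (Sum.map id Fin.castSucc v))).imp φ).all
  | bex {n : ℕ} {φ : setLang.BoundedFormula α (n + 1)} (v : α ⊕ Fin n) : IsDelta0 φ →
      IsDelta0 ((memT (&(Fin.last n))
        (FirstOrder.Language.Term.var (Sum.map id Fin.castSucc v))) ⊓ φ).ex

/-! ## Basic set-theoretic notions, as formulas -/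

/-- `x = ∅`. -/
def emptyF {n : ℕ} (x : Fin n) : SF n := allF fun u => ∼(u ∈' x↟)

/-- `x ⊆ y`. -/
def subF {n : ℕ} (x y : Fin n) : SF n := allF fun u => u ∈' x↟ ⟹ u ∈' y↟

/-- `z = {x, y}`. -/
def upairF {n : ℕ} (z x y : Fin n) : SF n := allF fun u => u ∈' z↟ ⇔ (u ≐ x↟ ⊔ u ≐ y↟)

/-- `p = ⟨x, y⟩`, the Kuratowski pair `{{x}, {x, y}}`. -/
def opairF {n : ℕ} (p x y : Fin n) : SF n :=
  allF fun u => u ∈' p↟ ⇔ (upairF u x↟ x↟ ⊔ upairF u x↟ y↟)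

/-- `c = ⟨x, y, z⟩ = ⟨x, ⟨y, z⟩⟩`. -/
def tripleF {n : ℕ} (c x y z : Fin n) : SF n :=
  exF fun q => opairF q y↟ z↟ ⊓ opairF c↟ x↟ q

/-- `⟨x, y⟩ ∈ r`. -/
def pairMemF {n : ℕ} (x y r : Fin n) : SF n := exF fun p => opairF p x↟ y↟ ⊓ p ∈' r↟

/-- `y = x ∪ {x}`. -/
def succF {n : ℕ} (y x : Fin n) : SF n := allF fun u => u ∈' y↟ ⇔ (u ∈' x↟ ⊔ u ≐ x↟)

/-- `x` is a transitive set. -/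
def transF {n : ℕ} (x : Fin n) : SF n := allF fun u => u ∈' x↟ ⟹ subF u x↟

/-- `x` is an ordinal: a transitive set of transitive sets. -/
def ordF {n : ℕ} (x : Fin n) : SF n := transF x ⊓ allF fun u => u ∈' x↟ ⟹ transF u

/-- `x` is a limit ordinal: a nonempty ordinal without a largest element. -/
def limitF {n : ℕ} (x : Fin n) : SF n :=
  ordF x ⊓ (exF fun u => u ∈' x↟) ⊓
    allF fun u => u ∈' x↟ ⟹ exF fun v => v ∈' x↟↟ ⊓ u↟ ∈' v

/-- `x` is a natural number (`x ∈ ω`): an ordinal such that no ordinal `≤ x` is a limit. -/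
def natF {n : ℕ} (x : Fin n) : SF n :=
  ordF x ⊓ ∼(limitF x) ⊓ allF fun u => u ∈' x↟ ⟹ ∼(limitF u)

/-- `f` is a function from `X` to `Y`, as a set of ordered pairs. -/
def funF {n : ℕ} (f X Y : Fin n) : SF n :=
  (allF fun p => p ∈' f↟ ⟹
    exF fun x => exF fun y => x↟ ∈' X↟↟↟ ⊓ y ∈' Y↟↟↟ ⊓ opairF p↟↟ x↟ y) ⊓
  (allF fun x => x ∈' X↟ ⟹
    exF fun y => pairMemF x↟ y f↟↟ ⊓ allF fun z => pairMemF x↟↟ z f↟↟↟ ⟹ z ≐ y↟)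

/-- `f` is a bijection from `X` to `Y`. -/
def bijF {n : ℕ} (f X Y : Fin n) : SF n :=
  funF f X Y ⊓
  (allF fun y => y ∈' Y↟ ⟹
    exF fun x => pairMemF x y↟ f↟↟ ⊓ allF fun z => pairMemF z y↟↟ f↟↟↟ ⟹ z ≐ x↟)

/-- `|x| < ω`: there is a bijection from a natural number to `x`. -/
def finiteF {n : ℕ} (x : Fin n) : SF n :=
  exF fun k => exF fun f => natF k↟ ⊓ bijF f k↟ x↟↟

/-- `R ⊆ X × X`. -/
def relOnF {n : ℕ} (R X : Fin n) : SF n :=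
  allF fun p => p ∈' R↟ ⟹
    exF fun u => exF fun v => u↟ ∈' X↟↟↟ ⊓ v ∈' X↟↟↟ ⊓ opairF p↟↟ u↟ v

/-- `R` is well founded on `X`: every nonempty `Y ⊆ X` has an `R`-minimal element. -/
def wfF {n : ℕ} (R X : Fin n) : SF n :=
  allF fun Y => (subF Y X↟ ⊓ ∼(emptyF Y)) ⟹
    exF fun u => u ∈' Y↟ ⊓ allF fun v => v ∈' Y↟↟ ⟹ ∼(pairMemF v u↟ R↟↟↟)

/-! ## The axioms of `B` and `C` -/

/-- Extensionality. -/
def extensionality : setLang.Sentence :=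
  allF fun x => allF fun y => (allF fun u => u ∈' x↟↟ ⇔ u ∈' y↟) ⟹ x↟ ≐ y

/-- Pair. -/
def pairing : setLang.Sentence :=
  allF fun x => allF fun y => exF fun z => upairF z x↟↟ y↟

/-- Union. -/
def union : setLang.Sentence :=
  allF fun x => exF fun z => allF fun u =>
    u ∈' z↟ ⇔ exF fun v => v ∈' x↟↟↟ ⊓ u↟ ∈' v

/-- Infinity: there is a limit ordinal. -/
def infinity : setLang.Sentence := exF fun x => limitF x

/-- Separation for the formula `φ(p₀, …, p_{n-1}, x)`, whose last variable is `x`: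
`∀ p₀ … p_{n-1} a, ∃ b, ∀ x, x ∈ b ↔ x ∈ a ∧ φ(p₀, …, p_{n-1}, x)`.
Here `pᵢ`, `a`, `b`, `x` are the bound variables number `i`, `n`, `n + 1`, `n + 2`. -/
def separation {n : ℕ} (φ : setLang.Formula (Fin (n + 1))) : setLang.Sentence :=
  FirstOrder.Language.BoundedFormula.alls (n := n)
    (allF fun a => exF fun b => allF fun x => x ∈' b↟ ⇔
      (x ∈' a↟↟ ⊓ FirstOrder.Language.BoundedFormula.relabel (n := n + 3) (k := 0)
        (fun i : Fin (n + 1) => Sum.inr (Fin.lastCases x (fun j : Fin n => j↟↟↟) i)) φ))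

/-- Regularity: every nonempty set has an `∈`-minimal element. -/
def regularity : setLang.Sentence :=
  allF fun x => ∼(emptyF x) ⟹
    exF fun u => u ∈' x↟ ⊓ allF fun v => v ∈' x↟↟ ⟹ ∼(v ∈' u↟)

/-- Transitive Closure: every set is included in a least transitive set. -/
def transitiveClosure : setLang.Sentence :=
  allF fun x => exF fun t => subF x↟ t ⊓ transF t ⊓
    allF fun s => (subF x↟↟ s ⊓ transF s) ⟹ subF t↟ s

/-- Finite Powerset: for every `x` the set of its finite subsets exists. -/
def finitePowerset : setLang.Sentence :=
  allF fun x => exF fun y => allF fun z => z ∈' y↟ ⇔ (subF z x↟↟ ⊓ finiteF z)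

/-- Axiom Beta: for every well founded relation `R` on a set `X` there are a transitive set `Y` and
a function `π : X → Y` with `π(u) = {π(v) : v ∈ X, ⟨v, u⟩ ∈ R}` for all `u ∈ X`. -/
def axiomBeta : setLang.Sentence :=
  allF fun X => allF fun R => (relOnF R X↟ ⊓ wfF R X↟) ⟹
    exF fun Y => exF fun π => transF Y↟ ⊓ funF π X↟↟↟ Y↟ ⊓
      allF fun u => u ∈' X↟↟↟↟ ⟹
        exF fun y => pairMemF u↟ y π↟↟ ⊓
          allF fun z => z ∈' y↟ ⇔
            exF fun v => v ∈' X↟↟↟↟↟↟↟ ⊓ pairMemF v u↟↟↟ R↟↟↟↟↟↟ ⊓ pairMemF v z↟ π↟↟↟↟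

/-- The theory `B`. -/
def theoryB : setLang.Theory :=
  {extensionality, pairing, union, infinity, regularity, transitiveClosure, finitePowerset} ∪
    {s | ∃ (n : ℕ) (φ : setLang.Formula (Fin (n + 1))), IsDelta0 φ ∧ s = separation φ}

/-- The theory `C`, that is, `B` together with Axiom Beta. -/
def theoryC : setLang.Theory := theoryB ∪ {axiomBeta}

/-! ## Formulas of set theory, coded as sets

The codes are `x_i ∈ x_j ↦ ⟨0, i, j⟩`, `x_i = x_j ↦ ⟨1, i, j⟩`, `θ ∧ ψ ↦ ⟨2, θ, ψ⟩`,
`θ ∨ ψ ↦ ⟨3, θ, ψ⟩`, `¬ θ ↦ ⟨4, θ⟩`, `∃ x_i θ ↦ ⟨5, i, θ⟩`, `∀ x_i θ ↦ ⟨6, i, θ⟩`. -/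

/-- `x` is the von Neumann numeral `k`. -/
def numF : ℕ → {n : ℕ} → Fin n → SF n
  | 0, _, x => emptyF x
  | k + 1, _, x => exF fun y => numF k y ⊓ succF x↟ y

/-- `c = ⟨k, x, y⟩`, where `k` is a numeral. -/
def codeF (k : ℕ) {n : ℕ} (c x y : Fin n) : SF n :=
  exF fun t => numF k t ⊓ tripleF c↟ t x↟ y↟

/-- `c` is the code of `x_i ∈ x_j`. -/
abbrev memCode {n : ℕ} (c i j : Fin n) : SF n := codeF 0 c i j

/-- `c` is the code of `x_i = x_j`. -/
abbrev eqCode {n : ℕ} (c i j : Fin n) : SF n := codeF 1 c i j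

/-- `c` is the code of `θ ∧ ψ`. -/
abbrev andCode {n : ℕ} (c θ ψ : Fin n) : SF n := codeF 2 c θ ψ

/-- `c` is the code of `θ ∨ ψ`. -/
abbrev orCode {n : ℕ} (c θ ψ : Fin n) : SF n := codeF 3 c θ ψ

/-- `c` is the code of `¬ θ`. -/
def negCode {n : ℕ} (c θ : Fin n) : SF n := exF fun t => numF 4 t ⊓ opairF c↟ t θ↟

/-- `c` is the code of `∃ x_i θ`. -/
abbrev exCode {n : ℕ} (c i θ : Fin n) : SF n := codeF 5 c i θ

/-- `c` is the code of `∀ x_i θ`. -/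
abbrev allCode {n : ℕ} (c i θ : Fin n) : SF n := codeF 6 c i θ

/-- `G` contains the codes of all atomic formulas and is closed under the formation of negations,
conjunctions, disjunctions and quantifications. -/
def formClosedF {n : ℕ} (G : Fin n) : SF n :=
  (allF fun i => allF fun j => allF fun c =>
    (natF i↟↟ ⊓ natF j↟ ⊓ (memCode c i↟↟ j↟ ⊔ eqCode c i↟↟ j↟)) ⟹ c ∈' G↟↟↟) ⊓
  (allF fun θ => allF fun ψ => allF fun c =>
    (θ↟↟ ∈' G↟↟↟ ⊓ ψ↟ ∈' G↟↟↟ ⊓ (andCode c θ↟↟ ψ↟ ⊔ orCode c θ↟↟ ψ↟)) ⟹ c ∈' G↟↟↟) ⊓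
  (allF fun θ => allF fun c => (θ↟ ∈' G↟↟ ⊓ negCode c θ↟) ⟹ c ∈' G↟↟) ⊓
  (allF fun i => allF fun θ => allF fun c =>
    (natF i↟↟ ⊓ θ↟ ∈' G↟↟↟ ⊓ (exCode c i↟↟ θ↟ ⊔ allCode c i↟↟ θ↟)) ⟹ c ∈' G↟↟↟)

/-- `F = Form`, the set of (codes of) all formulas: the least set with the above closure. -/
def formF {n : ℕ} (F : Fin n) : SF n :=
  formClosedF F ⊓ allF fun G => formClosedF G ⟹ subF F↟ G

/-- `V = {⟨θ, k⟩ : θ ∈ F, k ∈ FV(θ)}`, where `F` is the set of formulas and `FV(θ)` is the set of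
indices of free variables of `θ`. -/
def freeVarF {n : ℕ} (V F : Fin n) : SF n :=
  (allF fun p => p ∈' V↟ ⟹
    exF fun c => exF fun k => c↟ ∈' F↟↟↟ ⊓ natF k ⊓ opairF p↟↟ c↟ k) ⊓
  (allF fun c => allF fun k => (c↟ ∈' F↟↟ ⊓ natF k) ⟹
    ((allF fun i => allF fun j =>
        (memCode c↟↟↟ i↟ j ⊔ eqCode c↟↟↟ i↟ j) ⟹
          (pairMemF c↟↟↟ k↟↟ V↟↟↟↟ ⇔ (k↟↟ ≐ i↟ ⊔ k↟↟ ≐ j))) ⊓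
     (allF fun θ => allF fun ψ =>
        (andCode c↟↟↟ θ↟ ψ ⊔ orCode c↟↟↟ θ↟ ψ) ⟹
          (pairMemF c↟↟↟ k↟↟ V↟↟↟↟ ⇔ (pairMemF θ↟ k↟↟ V↟↟↟↟ ⊔ pairMemF ψ k↟↟ V↟↟↟↟))) ⊓
     (allF fun θ => negCode c↟↟ θ ⟹ (pairMemF c↟↟ k↟ V↟↟↟ ⇔ pairMemF θ k↟ V↟↟↟)) ⊓
     (allF fun i => allF fun θ =>
        (exCode c↟↟↟ i↟ θ ⊔ allCode c↟↟↟ i↟ θ) ⟹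
          (pairMemF c↟↟↟ k↟↟ V↟↟↟↟ ⇔ (pairMemF θ k↟↟ V↟↟↟↟ ⊓ ∼(k↟↟ ≐ i↟))))))

/-! ## Elementary diagrams -/

/-- `σ ∈ a^{<ω}` and `|σ| > max FV(c)`: `σ` is a function from a natural number `l` to `a`, and
`i < l` for every `i ∈ FV(c)`. The set `V` is as in `freeVarF`. -/
def assignF {n : ℕ} (a V c σ : Fin n) : SF n :=
  exF fun l => natF l ⊓ funF σ↟ l a↟ ⊓ allF fun i => pairMemF c↟↟ i V↟↟ ⟹ i ∈' l↟

/-- `τ = σ[b/x_i]`: the sequence `τ` has value `b` at `i`, and also at all `j < i` outside the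
domain of `σ`; elsewhere it agrees with `σ`. -/
def updateF {n : ℕ} (τ σ i b : Fin n) : SF n :=
  allF fun p => p ∈' τ↟ ⇔
    exF fun j => exF fun u => opairF p↟↟ j↟ u ⊓
      ((pairMemF j↟ u σ↟↟↟ ⊓ ∼(j↟ ≐ i↟↟↟)) ⊔
       (u ≐ b↟↟↟ ⊓ (j↟ ≐ i↟↟↟ ⊔
         (j↟ ∈' i↟↟↟ ⊓ ∼(exF fun w => pairMemF j↟↟ w σ↟↟↟↟)))))

/-- `H` agrees with the atomic facts of `(a, ∈)` at the formula `c` and the assignment `σ`. -/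
def atomicF {n : ℕ} (H c σ : Fin n) : SF n :=
  allF fun i => allF fun j =>
    (memCode c↟↟ i↟ j ⟹ (pairMemF c↟↟ σ↟↟ H↟↟ ⇔
      exF fun u => exF fun v => pairMemF i↟↟↟ u↟ σ↟↟↟↟ ⊓ pairMemF j↟↟ v σ↟↟↟↟ ⊓ u↟ ∈' v)) ⊓
    (eqCode c↟↟ i↟ j ⟹ (pairMemF c↟↟ σ↟↟ H↟↟ ⇔
      exF fun u => exF fun v => pairMemF i↟↟↟ u↟ σ↟↟↟↟ ⊓ pairMemF j↟↟ v σ↟↟↟↟ ⊓ u↟ ≐ v))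

/-- `H` satisfies the Tarski conditions for `(a, ∈)` at the formula `c` and the assignment `σ`. -/
def tarskiF {n : ℕ} (a H c σ : Fin n) : SF n :=
  (allF fun θ => allF fun ψ => andCode c↟↟ θ↟ ψ ⟹
    (pairMemF c↟↟ σ↟↟ H↟↟ ⇔ (pairMemF θ↟ σ↟↟ H↟↟ ⊓ pairMemF ψ σ↟↟ H↟↟))) ⊓
  (allF fun θ => allF fun ψ => orCode c↟↟ θ↟ ψ ⟹
    (pairMemF c↟↟ σ↟↟ H↟↟ ⇔ (pairMemF θ↟ σ↟↟ H↟↟ ⊔ pairMemF ψ σ↟↟ H↟↟))) ⊓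
  (allF fun θ => negCode c↟ θ ⟹ (pairMemF c↟ σ↟ H↟ ⇔ ∼(pairMemF θ σ↟ H↟))) ⊓
  (allF fun i => allF fun θ => exCode c↟↟ i↟ θ ⟹
    (pairMemF c↟↟ σ↟↟ H↟↟ ⇔
      exF fun b => b ∈' a↟↟↟ ⊓
        exF fun τ => updateF τ σ↟↟↟↟ i↟↟↟ b↟ ⊓ pairMemF θ↟↟ τ H↟↟↟↟)) ⊓
  (allF fun i => allF fun θ => allCode c↟↟ i↟ θ ⟹
    (pairMemF c↟↟ σ↟↟ H↟↟ ⇔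
      allF fun b => b ∈' a↟↟↟ ⟹
        exF fun τ => updateF τ σ↟↟↟↟ i↟↟↟ b↟ ⊓ pairMemF θ↟↟ τ H↟↟↟↟))

/-- `H` is an elementary diagram of `(a, ∈)`: a set of pairs `⟨θ, σ⟩`, where `θ ∈ Form` and
`σ ∈ a^{<ω}` is such that `|σ| > max FV(θ)`, which for all such `θ` and `σ` agrees with the atomic
facts and satisfies the Tarski conditions. That the set `Form` exists is part of the claim. -/
def diagramF {n : ℕ} (a H : Fin n) : SF n :=
  exF fun F => exF fun V => formF F↟ ⊓ freeVarF V F↟ ⊓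
    (allF fun p => p ∈' H↟↟↟ ⟹
      exF fun c => exF fun σ =>
        c↟ ∈' F↟↟↟↟ ⊓ assignF a↟↟↟↟↟ V↟↟↟ c↟ σ ⊓ opairF p↟↟ c↟ σ) ⊓
    (allF fun c => allF fun σ => (c↟ ∈' F↟↟↟ ⊓ assignF a↟↟↟↟ V↟↟ c↟ σ) ⟹
      (atomicF H↟↟↟↟ c↟ σ ⊓ tarskiF a↟↟↟↟ H↟↟↟↟ c↟ σ))

/-- The sentence `for all a, Th(a, ∈) exists`: every set `a` has exactly one elementary diagram. -/
def thExists : setLang.Sentence :=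
  allF fun a => exF fun H => diagramF a↟ H ⊓ allF fun H' => diagramF a↟↟ H' ⟹ H' ≐ H↟

end WeakSet

/-! Separation, and hence induction on ω, is available only for Δ₀ formulas with parameters, so
satisfaction cannot be defined by recursion on formulas directly. Axiom Beta supplies the missing
recursion: the collapse of a well founded relation is a recursively defined function, and suitable
relations make its values encode bits of information. The argument takes place in an arbitrary
model, whose axioms are recorded as `CModel`.

Syntax. Ackermann's relation "the m-th binary digit of n is 1" on ω is well founded, and its
collapse yields a transitive set `VV` closed under x ∪ {y} (`exists_hereditarilyFinite`), hence
containing all codes of formulas. Inside `VV`, "having a finite derivation" is Δ₀, since finite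
subsets of `VV` range over a set by Finite Powerset. This gives `Form`, and the same device gives
`FV`. Leastness of `Form`, and so induction on formulas, follows from Regularity (`Form_least`).

Truth. For any Δ₀ relation R on a set X, `exists_levels` produces W such that x is won at level n+1
iff some R-move from x leads to a position not won at level n, and nothing is won at level 0.
Indexing by levels makes the relation to be collapsed well founded whatever R is; two markers t and
f added to X serve as truth values at every level. The evaluation game of (a, ∈) is played with this
rule, everything being expressed by negation and existential choice (`exists_approx`). For a fixed
formula the outcome is constant from some level on, uniformly in the assignment
(`Approx.exists_stable`), and the eventual outcome is a truth definition (`exists_truth`).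
Restricting it to assignments covering the free variables gives the diagram; uniqueness is induction
on formulas. -/

namespace WeakSet

open FirstOrder.Language FirstOrder.Language.BoundedFormula

set_option linter.unusedSectionVars false

/-! ## Semantics of the basic formulas -/

section Semantics

variable {M : Type} [setLang.Structure M]

/-- The membership relation of a structure for the language of set theory. -/
instance instMembership : Membership M M :=
  ⟨fun y x => FirstOrder.Language.Structure.RelMap memSym ![x, y]⟩

variable {n : ℕ} {e : Empty → M} {xs : Fin n → M}

theorem realize_memT {α : Type} {s t : setLang.Term (α ⊕ Fin n)} {v : α → M} :
    (memT s t).Realize v xs ↔ s.realize (Sum.elim v xs) ∈ t.realize (Sum.elim v xs) :=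
  realize_rel₂

@[simp] theorem realize_memF {x y : Fin n} : (x ∈' y).Realize e xs ↔ xs x ∈ xs y :=
  realize_memT

@[simp] theorem realize_eqF {x y : Fin n} : (x ≐ y).Realize e xs ↔ xs x = xs y :=
  Iff.rfl

@[simp] theorem realize_allF {f : Fin (n + 1) → SF (n + 1)} :
    (allF f).Realize e xs ↔ ∀ a, (f (Fin.last n)).Realize e (Fin.snoc xs a : Fin (n + 1) → M) :=
  Iff.rfl

@[simp] theorem realize_exF {f : Fin (n + 1) → SF (n + 1)} :
    (exF f).Realize e xs ↔ ∃ a, (f (Fin.last n)).Realize e (Fin.snoc xs a : Fin (n + 1) → M) :=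
  realize_ex

/-- `z = {x, y}`. -/
def IsUpair (z x y : M) : Prop := ∀ u, u ∈ z ↔ (u = x ∨ u = y)

/-- `p = ⟨x, y⟩`. -/
def IsOpair (p x y : M) : Prop := ∀ u, u ∈ p ↔ (IsUpair u x x ∨ IsUpair u x y)

/-- `⟨x, y⟩ ∈ r`. -/
def PairMem (x y r : M) : Prop := ∃ p, IsOpair p x y ∧ p ∈ r

/-- `x ⊆ y`. -/
def Sub (x y : M) : Prop := ∀ u, u ∈ x → u ∈ y

/-- `y = x ∪ {x}`. -/
def IsSucc (y x : M) : Prop := ∀ u, u ∈ y ↔ (u ∈ x ∨ u = x)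

/-- `x` is transitive. -/
def Trans (x : M) : Prop := ∀ u, u ∈ x → Sub u x

/-- `x` is an ordinal. -/
def Ord (x : M) : Prop := Trans x ∧ ∀ u, u ∈ x → Trans u

/-- `x` is a limit ordinal. -/
def Limit (x : M) : Prop := (Ord x ∧ ∃ u, u ∈ x) ∧ ∀ u, u ∈ x → ∃ v, v ∈ x ∧ u ∈ v

/-- `x` is a natural number. -/
def IsNat (x : M) : Prop := (Ord x ∧ ¬ Limit x) ∧ ∀ u, u ∈ x → ¬ Limit u

/-- `f` is a function from `X` to `Y`. -/
def Fun (f X Y : M) : Prop :=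
  (∀ p, p ∈ f → ∃ x y, (x ∈ X ∧ y ∈ Y) ∧ IsOpair p x y) ∧
  ∀ x, x ∈ X → ∃ y, PairMem x y f ∧ ∀ z, PairMem x z f → z = y

/-- `f` is a bijection from `X` to `Y`. -/
def Bij (f X Y : M) : Prop :=
  Fun f X Y ∧ ∀ y, y ∈ Y → ∃ x, PairMem x y f ∧ ∀ z, PairMem z y f → z = x

/-- `x` is finite. -/
def Fin' (x : M) : Prop := ∃ k f, IsNat k ∧ Bij f k x

/-- `x` is the numeral `k`. -/
def IsNum : ℕ → M → Prop
  | 0, x => ∀ u, ¬ u ∈ x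
  | k + 1, x => ∃ y, IsNum k y ∧ IsSucc x y

/-- `c` is the triple of the numeral `k`, `x` and `y`. -/
def IsCode (k : ℕ) (c x y : M) : Prop :=
  ∃ t, IsNum k t ∧ ∃ q, IsOpair q x y ∧ IsOpair c t q

@[simp] theorem realize_emptyF {x : Fin n} : (emptyF x).Realize e xs ↔ ∀ u, ¬ u ∈ xs x := by
  simp [emptyF]

@[simp] theorem realize_subF {x y : Fin n} : (subF x y).Realize e xs ↔ Sub (xs x) (xs y) := by
  simp [subF, Sub]

@[simp] theorem realize_upairF {x y z : Fin n} :
    (upairF z x y).Realize e xs ↔ IsUpair (xs z) (xs x) (xs y) := by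
  simp [upairF, IsUpair]

@[simp] theorem realize_opairF {x y z : Fin n} :
    (opairF z x y).Realize e xs ↔ IsOpair (xs z) (xs x) (xs y) := by
  simp [opairF, IsOpair]

@[simp] theorem realize_pairMemF {x y r : Fin n} :
    (pairMemF x y r).Realize e xs ↔ PairMem (xs x) (xs y) (xs r) := by
  simp [pairMemF, PairMem]

@[simp] theorem realize_succF {x y : Fin n} : (succF y x).Realize e xs ↔ IsSucc (xs y) (xs x) := by
  simp [succF, IsSucc]

@[simp] theorem realize_transF {x : Fin n} : (transF x).Realize e xs ↔ Trans (xs x) := by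
  simp [transF, Trans]

@[simp] theorem realize_ordF {x : Fin n} : (ordF x).Realize e xs ↔ Ord (xs x) := by
  simp [ordF, Ord]

@[simp] theorem realize_limitF {x : Fin n} : (limitF x).Realize e xs ↔ Limit (xs x) := by
  simp [limitF, Limit]

@[simp] theorem realize_natF {x : Fin n} : (natF x).Realize e xs ↔ IsNat (xs x) := by
  simp [natF, IsNat]

@[simp] theorem realize_funF {f x y : Fin n} :
    (funF f x y).Realize e xs ↔ Fun (xs f) (xs x) (xs y) := by
  simp [funF, Fun]

@[simp] theorem realize_bijF {f x y : Fin n} :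
    (bijF f x y).Realize e xs ↔ Bij (xs f) (xs x) (xs y) := by
  simp [bijF, Bij]

@[simp] theorem realize_finiteF {x : Fin n} : (finiteF x).Realize e xs ↔ Fin' (xs x) := by
  simp [finiteF, Fin']

@[simp] theorem realize_numF {k : ℕ} : ∀ {n : ℕ} {xs : Fin n → M} {x : Fin n},
    (numF k x).Realize e xs ↔ IsNum k (xs x) := by
  induction k with
  | zero => intro n xs x; simp [numF, IsNum]
  | succ k ih => intro n xs x; simp [numF, IsNum, ih]

@[simp] theorem realize_codeF {k : ℕ} {c x y : Fin n} :
    (codeF k c x y).Realize e xs ↔ IsCode k (xs c) (xs x) (xs y) := by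
  simp [codeF, IsCode, tripleF]

end Semantics

/-! ## `Δ₀` predicates with parameters -/

section Delta0

variable {M : Type} [setLang.Structure M]

/-- The value of a variable or parameter. -/
def val {n : ℕ} (s : M ⊕ Fin n) (v : Fin n → M) : M := Sum.elim id v s

/-- `Δ₀` predicates with parameters, given semantically. -/
inductive Delta0 : {n : ℕ} → ((Fin n → M) → Prop) → Prop
  | falsum {n : ℕ} : Delta0 (fun _ : Fin n → M => False)
  | equal {n : ℕ} (s t : M ⊕ Fin n) : Delta0 (fun v => val s v = val t v)
  | mem {n : ℕ} (s t : M ⊕ Fin n) : Delta0 (fun v => val s v ∈ val t v)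
  | imp {n : ℕ} {P Q : (Fin n → M) → Prop} : Delta0 P → Delta0 Q → Delta0 (fun v => P v → Q v)
  | ball {n : ℕ} {P : (Fin (n + 1) → M) → Prop} (s : M ⊕ Fin n) : Delta0 P →
      Delta0 (fun v => ∀ z, z ∈ val s v → P (Fin.snoc v z))

/-- A semantic Δ₀ predicate mentions only finitely many elements of `M`, collected in `S`; naming
them by free variables turns it into a genuine formula. The last free variable is reserved for the
element being separated. The map `e`, sending variables to free or bound ones, is what lets the
induction pass under a quantifier. -/
theorem Delta0.exists_formula {n : ℕ} {P : (Fin n → M) → Prop} (h : Delta0 P) :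
    ∃ S : Finset M, ∀ (k l : ℕ) (e : Fin n → Fin (k + 1) ⊕ Fin l) (c : Fin k → M),
      (∀ a ∈ S, ∃ i, c i = a) → ∃ φ : setLang.BoundedFormula (Fin (k + 1)) l, IsDelta0 φ ∧
        ∀ (x : M) (xs : Fin l → M), φ.Realize (Fin.snoc c x : Fin (k + 1) → M) xs ↔
          P (fun i => Sum.elim (Fin.snoc c x : Fin (k + 1) → M) xs (e i)) := by
  classical
  have key : ∀ {n k l : ℕ} (s : M ⊕ Fin n) (e : Fin n → Fin (k + 1) ⊕ Fin l) (c : Fin k → M),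
      (∀ a, s = Sum.inl a → ∃ i, c i = a) → ∃ t : Fin (k + 1) ⊕ Fin l,
        ∀ (x : M) (xs : Fin l → M), Sum.elim (Fin.snoc c x : Fin (k + 1) → M) xs t =
          val s (fun i => Sum.elim (Fin.snoc c x : Fin (k + 1) → M) xs (e i)) := by
    intro n k l s e c hc
    rcases s with a | i
    · obtain ⟨i, hi⟩ := hc a rfl
      exact ⟨Sum.inl i.castSucc, fun x xs => by simp [val, hi]⟩
    · exact ⟨e i, fun x xs => rfl⟩
  let sup : ∀ {n : ℕ}, M ⊕ Fin n → Finset M := fun s => Sum.elim (fun a => {a}) (fun _ => ∅) s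
  have hsup : ∀ {n : ℕ} (s : M ⊕ Fin n) (a : M), s = Sum.inl a → a ∈ sup s := by
    rintro n s a rfl; simp [sup]
  induction h with
  | falsum => exact ⟨∅, fun k l e c _ => ⟨_, IsDelta0.falsum, fun x xs => Iff.rfl⟩⟩
  | equal s t =>
    refine ⟨sup s ∪ sup t, fun k l e c hc => ?_⟩
    obtain ⟨s', hs⟩ := key s e c fun a ha => hc a (by simp [hsup s a ha])
    obtain ⟨t', ht⟩ := key t e c fun a ha => hc a (by simp [hsup t a ha])
    refine ⟨_, IsDelta0.equal (Term.var s') (Term.var t'), fun x xs => ?_⟩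
    beta_reduce; rw [← hs, ← ht]; exact Iff.rfl
  | mem s t =>
    refine ⟨sup s ∪ sup t, fun k l e c hc => ?_⟩
    obtain ⟨s', hs⟩ := key s e c fun a ha => hc a (by simp [hsup s a ha])
    obtain ⟨t', ht⟩ := key t e c fun a ha => hc a (by simp [hsup t a ha])
    refine ⟨_, IsDelta0.mem (Term.var s') (Term.var t'), fun x xs => ?_⟩
    beta_reduce; rw [← hs, ← ht]; exact realize_memT
  | imp _ _ ih1 ih2 =>
    obtain ⟨S, hS⟩ := ih1
    obtain ⟨T, hT⟩ := ih2
    refine ⟨S ∪ T, fun k l e c hc => ?_⟩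
    obtain ⟨φ, h1, h2⟩ := hS k l e c fun a ha => hc a (by simp [ha])
    obtain ⟨ψ, h3, h4⟩ := hT k l e c fun a ha => hc a (by simp [ha])
    exact ⟨_, h1.imp h3, fun x xs => by rw [realize_imp, h2, h4]⟩
  | ball s _ ih =>
    obtain ⟨S, hS⟩ := ih
    refine ⟨S ∪ sup s, fun k l e c hc => ?_⟩
    obtain ⟨s', hs⟩ := key s e c fun a ha => hc a (by simp [hsup s a ha])
    obtain ⟨φ, h1, h2⟩ := hS k (l + 1)
      (Fin.snoc (fun i => Sum.map id Fin.castSucc (e i)) (Sum.inr (Fin.last l))) c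
      fun a ha => hc a (by simp [ha])
    refine ⟨_, h1.ball s', fun x xs => ?_⟩
    rw [realize_all]
    refine forall_congr' fun z => ?_
    rw [realize_imp, realize_memT, h2]
    refine imp_congr ?_ (iff_of_eq (congrArg _ (funext fun i => ?_)))
    · rw [← hs]
      rcases s' with i | i <;> simp
    · refine Fin.lastCases ?_ (fun i => ?_) i
      · simp
      · simp only [Fin.snoc_castSucc]
        rcases e i with j | j <;> simp

end Delta0

/-- Semantic form of the axioms of `C`. (Transitive Closure is not needed.) -/
class CModel (M : Type) [setLang.Structure M] : Prop where
  ext : ∀ x y : M, (∀ u, u ∈ x ↔ u ∈ y) → x = y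
  pair : ∀ x y : M, ∃ z, IsUpair z x y
  union : ∀ x : M, ∃ z : M, ∀ u, u ∈ z ↔ ∃ v, v ∈ x ∧ u ∈ v
  infinity : ∃ x : M, Limit x
  sep : ∀ P : (Fin 1 → M) → Prop, Delta0 P → ∀ a : M, ∃ b : M, ∀ x, x ∈ b ↔ x ∈ a ∧ P (fun _ => x)
  regularity : ∀ x : M, (¬ ∀ u, ¬ u ∈ x) → ∃ u, u ∈ x ∧ ∀ v, v ∈ x → ¬ v ∈ u
  finPow : ∀ x : M, ∃ y : M, ∀ z, z ∈ y ↔ Sub z x ∧ Fin' z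
  beta : ∀ X R : M,
    ((∀ p, p ∈ R → ∃ u v, (u ∈ X ∧ v ∈ X) ∧ IsOpair p u v) ∧
      ∀ Y : M, (Sub Y X ∧ ¬ ∀ u, ¬ u ∈ Y) → ∃ u, u ∈ Y ∧ ∀ v, v ∈ Y → ¬ PairMem v u R) →
    ∃ Y π : M, (Trans Y ∧ Fun π X Y) ∧ ∀ u, u ∈ X → ∃ y, PairMem u y π ∧
      ∀ z, z ∈ y ↔ ∃ v : M, (v ∈ X ∧ PairMem v u R) ∧ PairMem v z π

theorem cModel_of_models {M : Type} [setLang.Structure M] (h : M ⊨ theoryC) : CModel M := by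
  have hB : ∀ s ∈ theoryB, M ⊨ s := fun s hs => h.realize_of_mem s (Or.inl hs)
  have h0 : ∀ {s : setLang.Sentence}, M ⊨ s →
      BoundedFormula.Realize s (default : Empty → M) (default : Fin 0 → M) := fun h => h
  constructor
  · have := h0 (hB extensionality (by simp [theoryB]))
    simpa only [extensionality, realize_allF, realize_exF, realize_iff, realize_imp, realize_inf, realize_not,
      realize_emptyF, realize_subF, realize_upairF, realize_opairF, realize_pairMemF, realize_transF,
      realize_limitF, realize_funF, realize_finiteF, realize_memF, realize_eqF, Fin.snoc_last,
      Fin.snoc_castSucc] using this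
  · have := h0 (hB pairing (by simp [theoryB]))
    simpa only [pairing, realize_allF, realize_exF, realize_iff, realize_imp, realize_inf, realize_not,
      realize_emptyF, realize_subF, realize_upairF, realize_opairF, realize_pairMemF, realize_transF,
      realize_limitF, realize_funF, realize_finiteF, realize_memF, realize_eqF, Fin.snoc_last,
      Fin.snoc_castSucc] using this
  · have := h0 (hB union (by simp [theoryB]))
    simpa only [union, realize_allF, realize_exF, realize_iff, realize_imp, realize_inf, realize_not,
      realize_emptyF, realize_subF, realize_upairF, realize_opairF, realize_pairMemF, realize_transF,
      realize_limitF, realize_funF, realize_finiteF, realize_memF, realize_eqF, Fin.snoc_last,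
      Fin.snoc_castSucc] using this
  · have := h0 (hB infinity (by simp [theoryB]))
    simpa only [infinity, realize_allF, realize_exF, realize_iff, realize_imp, realize_inf, realize_not,
      realize_emptyF, realize_subF, realize_upairF, realize_opairF, realize_pairMemF, realize_transF,
      realize_limitF, realize_funF, realize_finiteF, realize_memF, realize_eqF, Fin.snoc_last,
      Fin.snoc_castSucc] using this
  · intro P hP a
    obtain ⟨S, hS⟩ := hP.exists_formula
    -- The parameters are enumerated by `S.equivFin`, and the single variable of `P` becomes the
    -- last free variable, the one ranging over the separated set.
    obtain ⟨φ, hφ, h1⟩ := hS S.card 0 (fun _ => Sum.inl (Fin.last _))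
      (fun i => (S.equivFin.symm i : M)) (fun a ha => ⟨S.equivFin ⟨a, ha⟩, by simp⟩)
    have := h0 (hB (separation φ) (Or.inr ⟨_, φ, hφ, rfl⟩))
    obtain ⟨b, hb⟩ := realize_exF.1 (realize_alls.1 this (fun i => (S.equivFin.symm i : M)) a)
    refine ⟨b, fun x => ?_⟩
    have := hb x
    rw [realize_iff, realize_inf, realize_relabel, realize_memF, realize_memF] at this
    simp only [Fin.snoc_last, Fin.snoc_castSucc] at this
    rw [this]
    refine and_congr_right fun _ => ?_
    have h2 := h1 x default
    simp only [Sum.elim_inl, Fin.snoc_last] at h2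
    rw [← h2]
    refine iff_of_eq (congrArg₂ _ (funext fun i => ?_) (Subsingleton.elim _ _))
    refine Fin.lastCases ?_ (fun i => ?_) i
    · simp
    · simp
  · have := h0 (hB regularity (by simp [theoryB]))
    simpa only [regularity, realize_allF, realize_exF, realize_iff, realize_imp, realize_inf, realize_not,
      realize_emptyF, realize_subF, realize_upairF, realize_opairF, realize_pairMemF, realize_transF,
      realize_limitF, realize_funF, realize_finiteF, realize_memF, realize_eqF, Fin.snoc_last,
      Fin.snoc_castSucc] using this
  · have := h0 (hB finitePowerset (by simp [theoryB]))
    simpa only [finitePowerset, realize_allF, realize_exF, realize_iff, realize_imp, realize_inf, realize_not,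
      realize_emptyF, realize_subF, realize_upairF, realize_opairF, realize_pairMemF, realize_transF,
      realize_limitF, realize_funF, realize_finiteF, realize_memF, realize_eqF, Fin.snoc_last,
      Fin.snoc_castSucc] using this
  · have := h0 (h.realize_of_mem axiomBeta (Or.inr rfl))
    simpa only [axiomBeta, relOnF, wfF, realize_allF, realize_exF, realize_iff, realize_imp, realize_inf, realize_not,
      realize_emptyF, realize_subF, realize_upairF, realize_opairF, realize_pairMemF, realize_transF,
      realize_limitF, realize_funF, realize_finiteF, realize_memF, realize_eqF, Fin.snoc_last,
      Fin.snoc_castSucc] using this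

/-! ### Closure of Δ₀ predicates under connectives, bounded quantifiers and terms -/

section

variable {M : Type} [setLang.Structure M] {n : ℕ}

namespace Delta0

variable {P Q : (Fin n → M) → Prop}

theorem congr (h : Delta0 P) (hPQ : ∀ v, P v ↔ Q v) : Delta0 Q := by
  rwa [← show P = Q from funext fun v => propext (hPQ v)]

theorem not (h : Delta0 P) : Delta0 (fun v => ¬ P v) := h.imp .falsum

theorem and (h : Delta0 P) (h' : Delta0 Q) : Delta0 (fun v => P v ∧ Q v) :=
  (h.imp h'.not).not.congr fun v => by tauto

theorem or (h : Delta0 P) (h' : Delta0 Q) : Delta0 (fun v => P v ∨ Q v) :=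
  (h.not.imp h').congr fun v => by tauto

theorem iff (h : Delta0 P) (h' : Delta0 Q) : Delta0 (fun v => P v ↔ Q v) :=
  ((h.imp h').and (h'.imp h)).congr fun v => by tauto

end Delta0

/-- `P` is a `Δ₀` predicate with parameters. -/
class D0 (P : (Fin n → M) → Prop) : Prop where
  out : Delta0 P

theorem D0.congr {P Q : (Fin n → M) → Prop} (h : ∀ v, P v ↔ Q v) [hP : D0 P] : D0 Q :=
  ⟨hP.out.congr h⟩

/-- `f` is a term that can be used as a bound of quantifiers in `Δ₀` predicates. -/
class Tm (f : (Fin n → M) → M) : Prop where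
  out : ∀ (m : ℕ) (ρ : Fin n → Fin m) (Q : (Fin (m + 1) → M) → Prop), Delta0 Q →
    Delta0 (fun v => ∀ z, z ∈ f (fun i => v (ρ i)) → Q (Fin.snoc v z))

instance Tm.var (i : Fin n) : Tm (fun v : Fin n → M => v i) :=
  ⟨fun _ ρ _ hQ => .ball (Sum.inr (ρ i)) hQ⟩

instance Tm.const (c : M) : Tm (fun _ : Fin n → M => c) := ⟨fun _ _ _ hQ => .ball (Sum.inl c) hQ⟩

instance (priority := low) Tm.weaken (f : (Fin n → M) → M) [h : Tm f] {m : ℕ} (ρ : Fin n → Fin m) :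
    Tm (fun v : Fin m → M => f (fun i => v (ρ i))) :=
  ⟨fun k σ Q hQ => h.out k (fun i => σ (ρ i)) Q hQ⟩

theorem Tm.val (s : M ⊕ Fin n) {m : ℕ} (F : Fin n → (Fin m → M) → M) (hF : ∀ i, Tm (F i)) :
    Tm (fun v => val s (fun i => F i v)) := by
  rcases s with a | i
  · exact Tm.const a
  · exact hF i

/-- An element lies in `f` iff not every member of `f` differs from it, so membership in a term
reduces to quantification bounded by that term. -/
theorem Tm.delta0_mem_last (f : (Fin n → M) → M) [h : Tm f] :
    Delta0 (fun w : Fin (n + 1) → M => w (Fin.last n) ∈ f (fun i => w i.castSucc)) :=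
  ((h.out (n + 1) Fin.castSucc (fun u => ¬ u (Fin.last _) = u (Fin.last n).castSucc)
    (Delta0.not (.equal (Sum.inr _) (Sum.inr _)))).not).congr fun v => by simp

open Classical in
/-- `{x ∈ a | P x}`, for `Δ₀` predicates `P`. -/
noncomputable def sep (a : M) (P : M → Prop) : M :=
  if h : ∃ b : M, ∀ x, x ∈ b ↔ x ∈ a ∧ P x then h.choose else a

variable [CModel M]

theorem ext {x y : M} (h : ∀ u, u ∈ x ↔ u ∈ y) : x = y := CModel.ext _ _ h

/-- By extensionality, equality with a term is a pair of inclusions, each a bounded quantifier. -/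
theorem Tm.delta0_eq_last (f : (Fin n → M) → M) [h : Tm f] :
    Delta0 (fun w : Fin (n + 1) → M => w (Fin.last n) = f (fun i => w i.castSucc)) := by
  have h1 : Delta0 (fun w : Fin (n + 1) → M =>
      ∀ y, y ∈ w (Fin.last n) → y ∈ f (fun i => w i.castSucc)) := by
    have := Tm.weaken f (Fin.castSucc (n := n))
    refine (Delta0.ball (Sum.inr (Fin.last n)) (Tm.delta0_mem_last
      (fun v : Fin (n + 1) → M => f (fun i => v i.castSucc)))).congr fun v => ?_
    simp [WeakSet.val]
  have h2 := h.out (n + 1) Fin.castSucc (fun u => u (Fin.last _) ∈ u (Fin.last n).castSucc)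
    (.mem (Sum.inr _) (Sum.inr _))
  refine (h1.and h2).congr fun v => ⟨fun ⟨a, b⟩ => ext fun u => ⟨a u, fun hu => ?_⟩, fun h => ?_⟩
  · simpa using b u hu
  · rw [← h]; simp

theorem Tm.delta0_eq (f g : (Fin n → M) → M) [hf : Tm f] [hg : Tm g] :
    Delta0 (fun v => f v = g v) := by
  refine ((hf.out n id _ (Tm.delta0_mem_last g)).and
    (hg.out n id _ (Tm.delta0_mem_last f))).congr fun v => ?_
  simp only [id, Fin.snoc_last, Fin.snoc_castSucc]
  exact ⟨fun ⟨a, b⟩ => ext fun u => ⟨a u, b u⟩, fun h => by simp [h]⟩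

theorem Tm.delta0_mem (f g : (Fin n → M) → M) [hf : Tm f] [hg : Tm g] :
    Delta0 (fun v => f v ∈ g v) := by
  refine (hg.out n id _ (Tm.delta0_eq_last f).not).not.congr fun v => ?_
  simp

/-- Set operations such as pairing and union are not symbols of the language, yet they may replace
variables in Δ₀ predicates: `Tm` handles them as bounds of quantifiers, and the two preceding
results handle them in atomic predicates. This is what allows Δ₀-ness to be found by instance
search. -/
theorem Delta0.subst {P : (Fin n → M) → Prop} (h : Delta0 P) :
    ∀ {m : ℕ} (F : Fin n → (Fin m → M) → M), (∀ i, Tm (F i)) →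
      Delta0 (fun v => P (fun i => F i v)) := by
  induction h with
  | falsum => exact fun _ _ => .falsum
  | equal s t => exact fun F hF => have := Tm.val s F hF; have := Tm.val t F hF; Tm.delta0_eq _ _
  | mem s t => exact fun F hF => have := Tm.val s F hF; have := Tm.val t F hF; Tm.delta0_mem _ _
  | imp _ _ ih1 ih2 => exact fun F hF => (ih1 F hF).imp (ih2 F hF)
  | @ball n P s _ ih =>
    intro m F hF
    have h1 := (Tm.val s F hF).out m id _ (ih
      (Fin.lastCases (fun v => v (Fin.last m)) fun i v => F i (fun j => v j.castSucc))
      (Fin.lastCases (by simpa using Tm.var _) fun i => by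
        have := hF i
        simpa using Tm.weaken (F i) _))
    refine h1.congr fun v => forall_congr' fun z => imp_congr_right fun _ =>
      iff_of_eq (congrArg _ (funext fun i => ?_))
    refine Fin.lastCases ?_ (fun i => ?_) i <;> simp

theorem Delta0.subst_last {Q : (Fin (n + 1) → M) → Prop} (h : Delta0 Q) (g : (Fin n → M) → M)
    [hg : Tm g] : Delta0 (fun v => Q (Fin.snoc v (g v))) := by
  refine (h.subst (Fin.lastCases g fun i v => v i)
    (Fin.lastCases (by simpa using hg) fun i => by simpa using Tm.var i)).congr fun v =>
      iff_of_eq (congrArg _ (funext fun i => ?_))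
  refine Fin.lastCases ?_ (fun i => ?_) i <;> simp

/-! ### Instances for `Δ₀` predicates -/

variable {P Q : (Fin n → M) → Prop}

instance D0.mem (f g : (Fin n → M) → M) [Tm f] [Tm g] : D0 (fun v => f v ∈ g v) :=
  ⟨Tm.delta0_mem f g⟩
instance D0.eq (f g : (Fin n → M) → M) [Tm f] [Tm g] : D0 (fun v => f v = g v) :=
  ⟨Tm.delta0_eq f g⟩
instance D0.and [h : D0 P] [h' : D0 Q] : D0 (fun v => P v ∧ Q v) := ⟨h.out.and h'.out⟩
instance D0.or [h : D0 P] [h' : D0 Q] : D0 (fun v => P v ∨ Q v) := ⟨h.out.or h'.out⟩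
instance D0.imp [h : D0 P] [h' : D0 Q] : D0 (fun v => P v → Q v) := ⟨h.out.imp h'.out⟩
instance D0.iff [h : D0 P] [h' : D0 Q] : D0 (fun v => P v ↔ Q v) := ⟨h.out.iff h'.out⟩
instance D0.const (p : Prop) : D0 (fun _ : Fin n → M => p) := by
  by_cases hp : p
  · exact ⟨Delta0.falsum.not.congr fun _ => by simp [hp]⟩
  · exact ⟨Delta0.falsum.congr fun _ => by simp [hp]⟩

instance D0.ball {P : (Fin n → M) → M → Prop} (f : (Fin n → M) → M) [hf : Tm f]
    [h : D0 (fun w : Fin (n + 1) → M => P (fun i => w i.castSucc) (w (Fin.last n)))] :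
    D0 (fun v => ∀ z, z ∈ f v → P v z) :=
  ⟨(hf.out n id _ h.out).congr fun v => by simp⟩

instance D0.bex {P : (Fin n → M) → M → Prop} (f : (Fin n → M) → M) [hf : Tm f]
    [h : D0 (fun w : Fin (n + 1) → M => P (fun i => w i.castSucc) (w (Fin.last n)))] :
    D0 (fun v => ∃ z, z ∈ f v ∧ P v z) :=
  ⟨(hf.out n id _ h.out.not).not.congr fun v => by simp⟩

/-- Instance search cannot unfold a predicate variable; this and its analogues provide the instances
by hand in proofs about arbitrary Δ₀ predicates. -/
theorem D0.comp (P : M → Prop) [h : D0 (fun v : Fin 1 → M => P (v 0))] {n : ℕ}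
    (t : (Fin n → M) → M) [ht : Tm t] : D0 (fun v => P (t v)) :=
  ⟨h.out.subst (fun _ => t) fun _ => ht⟩

theorem D0.comp₂ (P : M → M → Prop) [h : D0 (fun v : Fin 2 → M => P (v 0) (v 1))] {n : ℕ}
    (s t : (Fin n → M) → M) [hs : Tm s] [ht : Tm t] : D0 (fun v => P (s v) (t v)) :=
  ⟨h.out.subst ![s, t] fun i => by fin_cases i; exacts [hs, ht]⟩

theorem D0.comp₃ (P : M → M → M → Prop) [h : D0 (fun v : Fin 3 → M => P (v 0) (v 1) (v 2))]
    {n : ℕ} (s t u : (Fin n → M) → M) [hs : Tm s] [ht : Tm t] [hu : Tm u] :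
    D0 (fun v => P (s v) (t v) (u v)) :=
  ⟨h.out.subst ![s, t, u] fun i => by fin_cases i; exacts [hs, ht, hu]⟩

/-! ### Separation and other set-theoretic operations -/

@[simp] theorem mem_sep {a : M} {P : M → Prop} [h : D0 (fun v : Fin 1 → M => P (v 0))] {x : M} :
    x ∈ sep a P ↔ x ∈ a ∧ P x := by
  have h' : ∃ b : M, ∀ x, x ∈ b ↔ x ∈ a ∧ P x := CModel.sep _ h.out a
  rw [sep, dif_pos h']
  exact h'.choose_spec x

/-- All variables but the last are frozen into parameters, as separation requires. -/
theorem D0.inst_last {P : (Fin n → M) → M → Prop}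
    [h : D0 (fun w : Fin (n + 1) → M => P (fun i => w i.castSucc) (w (Fin.last n)))]
    (v : Fin n → M) : D0 (fun u : Fin 1 → M => P v (u 0)) :=
  ⟨(h.out.subst (m := 1) (Fin.lastCases (fun u => u 0) fun i _ => v i)
    (Fin.lastCases (by simpa using Tm.var _) fun i => by simpa using Tm.const _)).congr
      fun u => by simp⟩

instance Tm.sep (f : (Fin n → M) → M) {P : (Fin n → M) → M → Prop} [hf : Tm f]
    [h : D0 (fun w : Fin (n + 1) → M => P (fun i => w i.castSucc) (w (Fin.last n)))] :
    Tm (fun v => sep (f v) (P v)) := by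
  refine ⟨fun m ρ Q hQ => ?_⟩
  refine (hf.out m ρ _ (Delta0.imp (h.out.subst (m := m + 1)
    (Fin.lastCases (fun u => u (Fin.last m)) fun i u => u (ρ i).castSucc)
    (Fin.lastCases (by simpa using Tm.var _) fun i => by simpa using Tm.var _)) hQ)).congr
      fun v => ?_
  have := fun v => D0.inst_last (P := P) v
  simp

/-- `{x, y}`. -/
noncomputable def pr (x y : M) : M := (CModel.pair x y).choose

@[simp] theorem mem_pr {x y u : M} : u ∈ pr x y ↔ u = x ∨ u = y := (CModel.pair x y).choose_spec u

instance Tm.pr (f g : (Fin n → M) → M) [hf : Tm f] [hg : Tm g] : Tm (fun v => pr (f v) (g v)) := by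
  refine ⟨fun m ρ Q hQ => ?_⟩
  have := Tm.weaken f ρ
  have := Tm.weaken g ρ
  exact ((hQ.subst_last (fun v => f fun i => v (ρ i))).and
    (hQ.subst_last (fun v => g fun i => v (ρ i)))).congr fun v => by simp

/-- `⋃ x`. -/
noncomputable def bU (x : M) : M := (CModel.union x).choose

@[simp] theorem mem_bU {x u : M} : u ∈ bU x ↔ ∃ v, v ∈ x ∧ u ∈ v := (CModel.union x).choose_spec u

instance Tm.bU (f : (Fin n → M) → M) [hf : Tm f] : Tm (fun v => bU (f v)) := by
  refine ⟨fun m ρ Q hQ => ?_⟩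
  have := Tm.weaken f ρ
  have h2 : Delta0 (fun w : Fin (m + 1) → M => ∀ z, z ∈ w (Fin.last m) →
      Q (Fin.snoc (fun i => w i.castSucc) z)) := by
    refine (Delta0.ball (Sum.inr (Fin.last m)) (hQ.subst (m := m + 2)
      (Fin.lastCases (fun u => u (Fin.last _)) fun i u => u i.castSucc.castSucc)
      (Fin.lastCases (by simpa using Tm.var _) fun i => by simpa using Tm.var _))).congr
        fun v => ?_
    refine forall_congr' fun z => imp_congr_right fun _ =>
      iff_of_eq (congrArg _ (funext fun i => ?_))
    refine Fin.lastCases ?_ (fun i => ?_) i <;> simp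
  exact (hf.out m ρ _ h2).congr fun v => by simp; grind

/-- The empty set. -/
noncomputable def emp : M := sep (CModel.infinity (M := M)).choose fun _ => False

@[simp] theorem not_mem_emp {x : M} : ¬ x ∈ (emp : M) := by simp [emp]

/-- `{x}`. -/
noncomputable def sg (x : M) : M := pr x x

@[simp] theorem mem_sg {x u : M} : u ∈ sg x ↔ u = x := by simp [sg]

instance Tm.sg (f : (Fin n → M) → M) [hf : Tm f] : Tm (fun v => sg (f v)) := by
  unfold WeakSet.sg; infer_instance

/-- `x ∪ y`. -/
noncomputable def un (x y : M) : M := bU (pr x y)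

@[simp] theorem mem_un {x y u : M} : u ∈ un x y ↔ u ∈ x ∨ u ∈ y := by simp [un]

instance Tm.un (f g : (Fin n → M) → M) [Tm f] [Tm g] : Tm (fun v => un (f v) (g v)) := by
  unfold WeakSet.un; infer_instance

/-- `x ∪ {y}`. -/
noncomputable def ins (x y : M) : M := un x (sg y)

@[simp] theorem mem_ins {x y u : M} : u ∈ ins x y ↔ u ∈ x ∨ u = y := by simp [ins]

instance Tm.ins (f g : (Fin n → M) → M) [Tm f] [Tm g] : Tm (fun v => ins (f v) (g v)) := by
  unfold WeakSet.ins; infer_instance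

/-- `⟨x, y⟩`. -/
noncomputable def op (x y : M) : M := pr (sg x) (pr x y)

instance Tm.op (f g : (Fin n → M) → M) [Tm f] [Tm g] : Tm (fun v => op (f v) (g v)) := by
  unfold WeakSet.op; infer_instance

theorem isUpair_iff {z x y : M} : IsUpair z x y ↔ z = pr x y :=
  ⟨fun h => ext fun u => by rw [h u]; simp, fun h u => by simp [h]⟩

theorem isOpair_iff {z x y : M} : IsOpair z x y ↔ z = op x y := by
  simp only [IsOpair, isUpair_iff]
  exact ⟨fun h => ext fun u => by rw [h u]; simp [op, sg], fun h u => by simp [h, op, sg]⟩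

theorem pairMem_iff {x y r : M} : PairMem x y r ↔ op x y ∈ r := by simp [PairMem, isOpair_iff]

theorem pr_eq_pr {x y u v : M} (h : pr x y = pr u v) : (x = u ∧ y = v) ∨ (x = v ∧ y = u) := by
  have h1 : ∀ z, z = x ∨ z = y ↔ z = u ∨ z = v := fun z => by rw [← mem_pr, h, mem_pr]
  have := h1 x
  have := h1 y
  have := h1 u
  have := h1 v
  grind

@[simp] theorem op_inj {x y u v : M} : op x y = op u v ↔ x = u ∧ y = v := by
  refine ⟨fun h => ?_, fun ⟨h, h'⟩ => by rw [h, h']⟩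
  rcases pr_eq_pr h with ⟨h1, h2⟩ | ⟨h1, h2⟩
  · rcases pr_eq_pr h1 with ⟨h3, _⟩ | ⟨h3, _⟩ <;> rcases pr_eq_pr h2 with h4 | h4 <;> grind
  · rcases pr_eq_pr h1 with ⟨h3, _⟩ | ⟨h3, _⟩ <;> rcases pr_eq_pr h2 with h4 | h4 <;> grind

instance D0.sub (f g : (Fin n → M) → M) [Tm f] [Tm g] : D0 (fun v => Sub (f v) (g v)) := by
  unfold Sub; infer_instance

theorem regularity' (x : M) {y : M} (hy : y ∈ x) : ∃ u, u ∈ x ∧ ∀ v, v ∈ x → ¬ v ∈ u :=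
  CModel.regularity x fun h => h y hy

theorem mem_irrefl (x : M) : ¬ x ∈ x := by
  obtain ⟨u, hu, h⟩ := regularity' (sg x) (mem_sg.2 rfl)
  simp only [mem_sg, forall_eq] at hu h
  rwa [hu] at h

theorem mem_asymm {x y : M} (h : x ∈ y) : ¬ y ∈ x := by
  intro h'
  obtain ⟨u, hu, h1⟩ := regularity' (pr x y) (mem_pr.2 (Or.inl rfl))
  simp only [mem_pr, forall_eq_or_imp, forall_eq] at hu h1
  grind

end

section

variable {M : Type} [setLang.Structure M] [CModel M] {n : ℕ}

/-! ## Ordinals and natural numbers -/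

instance D0.trans (f : (Fin n → M) → M) [Tm f] : D0 (fun v => Trans (f v)) := by
  unfold Trans; infer_instance

instance D0.ord (f : (Fin n → M) → M) [Tm f] : D0 (fun v => Ord (f v)) := by
  unfold Ord; infer_instance

instance D0.limit (f : (Fin n → M) → M) [Tm f] : D0 (fun v => Limit (f v)) :=
  D0.congr (P := fun v => (Ord (f v) ∧ ∃ u, u ∈ f v ∧ u = u) ∧
    ∀ u, u ∈ f v → ∃ w, w ∈ f v ∧ u ∈ w) fun v => by simp [Limit]

instance D0.isNat (f : (Fin n → M) → M) [Tm f] : D0 (fun v => IsNat (f v)) := by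
  unfold IsNat; infer_instance

/-- `x ∪ {x}`. -/
noncomputable def sc (x : M) : M := ins x x

@[simp] theorem mem_sc {x u : M} : u ∈ sc x ↔ u ∈ x ∨ u = x := by simp [sc]

instance Tm.sc (f : (Fin n → M) → M) [Tm f] : Tm (fun v => sc (f v)) := by
  unfold WeakSet.sc; infer_instance

theorem isSucc_iff {x y : M} : IsSucc y x ↔ y = sc x :=
  ⟨fun h => ext fun u => by rw [h u]; simp, fun h u => by simp [h]⟩

theorem Ord.mem {x u : M} (h : Ord x) (hu : u ∈ x) : Ord u :=
  ⟨h.2 u hu, fun v hv => h.2 v (h.1 u hu v hv)⟩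

theorem Ord.sc {x : M} (h : Ord x) : Ord (sc x) := by
  refine ⟨fun u hu v hv => ?_, fun u hu => ?_⟩
  · rcases mem_sc.1 hu with hu | rfl
    · exact mem_sc.2 (Or.inl (h.1 u hu v hv))
    · exact mem_sc.2 (Or.inl hv)
  · rcases mem_sc.1 hu with hu | rfl
    · exact h.2 u hu
    · exact h.1

/-- Regularity replaces transfinite induction: take a minimal a ≤ x incomparable with some ordinal ≤
y, then a minimal such b. Minimality makes each member of either one a member of the other, so a =
b, a contradiction. -/
theorem Ord.compare {x y : M} (hx : Ord x) (hy : Ord y) : x ∈ y ∨ x = y ∨ y ∈ x := by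
  by_contra hxy
  have hx' := hx.sc
  have hy' := hy.sc
  obtain ⟨a, ha, hamin⟩ := regularity' (WeakSet.sep (WeakSet.sc x) fun a =>
    ∃ b, b ∈ WeakSet.sc y ∧ ¬ (a ∈ b ∨ a = b ∨ b ∈ a)) (y := x) (by simp; grind)
  obtain ⟨ha, b₀, hb₀, hab₀⟩ := mem_sep.1 ha
  obtain ⟨b, hb, hbmin⟩ := regularity' (WeakSet.sep (WeakSet.sc y) fun b =>
    ¬ (a ∈ b ∨ a = b ∨ b ∈ a)) (y := b₀) (mem_sep.2 ⟨hb₀, hab₀⟩)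
  obtain ⟨hb, hab⟩ := mem_sep.1 hb
  refine hab (Or.inr (Or.inl (ext fun u => ⟨fun hu => ?_, fun hu => ?_⟩)))
  · by_contra hub
    refine hamin u (mem_sep.2 ⟨hx'.1 a ha u hu, b, hb, ?_⟩) hu
    rintro (h | rfl | h)
    · exact hub h
    · exact hab (Or.inr (Or.inr hu))
    · exact hab (Or.inr (Or.inr ((hx'.mem ha).1 u hu b h)))
  · by_contra hua
    refine hbmin u (mem_sep.2 ⟨hy'.1 b hb u hu, ?_⟩) hu
    rintro (h | rfl | h)
    · exact hab (Or.inl ((hy'.mem hb).1 u hu a h))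
    · exact hab (Or.inl hu)
    · exact hua h

theorem IsNat.mem {x u : M} (h : IsNat x) (hu : u ∈ x) : IsNat u :=
  ⟨⟨h.1.1.mem hu, h.2 u hu⟩, fun v hv => h.2 v (h.1.1.1 u hu v hv)⟩

theorem isNat_emp : IsNat (emp : M) := by simp [IsNat, Ord, Limit, Trans]

theorem IsNat.sc {x : M} (h : IsNat x) : IsNat (sc x) := by
  refine ⟨⟨h.1.1.sc, fun hl => ?_⟩, fun u hu => ?_⟩
  · obtain ⟨v, hv, hxv⟩ := hl.2 x (by simp)
    rcases mem_sc.1 hv with hv | rfl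
    · exact mem_asymm hv hxv
    · exact mem_irrefl _ hxv
  · rcases mem_sc.1 hu with hu | rfl
    · exact h.2 u hu
    · exact h.1.2

/-- The set of natural numbers. -/
noncomputable def omg : M := sep (CModel.infinity (M := M)).choose IsNat

/-- A natural number is comparable with the limit ordinal given by Infinity, and can neither equal
nor exceed it because no ordinal up to it is a limit. -/
theorem mem_omg {x : M} : x ∈ (omg : M) ↔ IsNat x := by
  have hl := (CModel.infinity (M := M)).choose_spec
  simp only [omg, mem_sep, and_iff_right_iff_imp]
  intro hx
  rcases hx.1.1.compare hl.1.1 with h | h | h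
  · exact h
  · exact absurd (h ▸ hl) hx.1.2
  · exact absurd hl (hx.2 _ h)

theorem emp_mem_omg : (emp : M) ∈ (omg : M) := mem_omg.2 isNat_emp

theorem sc_mem_omg {x : M} (h : x ∈ (omg : M)) : sc x ∈ (omg : M) := mem_omg.2 (mem_omg.1 h).sc

theorem mem_omg_of_mem {x y : M} (hx : x ∈ (omg : M)) (hy : y ∈ x) : y ∈ (omg : M) :=
  mem_omg.2 ((mem_omg.1 hx).mem hy)

theorem omg_trans {x y z : M} (hx : x ∈ (omg : M)) (hy : y ∈ x) (hz : z ∈ y) : z ∈ x :=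
  (mem_omg.1 hx).1.1.1 y hy z hz

theorem omg_compare {x y : M} (hx : x ∈ (omg : M)) (hy : y ∈ (omg : M)) :
    x ∈ y ∨ x = y ∨ y ∈ x := (mem_omg.1 hx).1.1.compare (mem_omg.1 hy).1.1

theorem omg_cases {x : M} (hx : x ∈ (omg : M)) : x = emp ∨ ∃ u, u ∈ (omg : M) ∧ x = sc u := by
  have h := (mem_omg.1 hx).1.2
  by_cases h0 : ∃ u, u ∈ x
  · right
    have : ∃ u, u ∈ x ∧ ∀ v, v ∈ x → ¬ u ∈ v := by
      by_contra h1
      push Not at h1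
      exact h ⟨⟨(mem_omg.1 hx).1.1, h0⟩, h1⟩
    obtain ⟨u, hu, hm⟩ := this
    have hu' := mem_omg_of_mem hx hu
    refine ⟨u, hu', ext fun v => ⟨fun hv => ?_, fun hv => ?_⟩⟩
    · have := omg_compare hu' (mem_omg_of_mem hx hv)
      have := hm v hv
      simp; grind
    · rcases mem_sc.1 hv with hv | rfl
      · exact omg_trans hx hu hv
      · exact hu
  · left
    exact ext fun u => by simp; grind

/-- The counterexamples form a set only because `P` is Δ₀; Regularity then gives a minimal one. -/
theorem omg_induction {P : M → Prop} [h : D0 (fun v : Fin 1 → M => P (v 0))] (h0 : P emp)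
    (hs : ∀ x, x ∈ (omg : M) → P x → P (sc x)) : ∀ x, x ∈ (omg : M) → P x := by
  intro x hx
  by_contra hPx
  obtain ⟨u, hu, hm⟩ := regularity' (sep omg fun x => ¬ P x) (mem_sep.2 ⟨hx, hPx⟩)
  obtain ⟨hu, hPu⟩ := mem_sep.1 hu
  rcases omg_cases hu with rfl | ⟨v, hv, rfl⟩
  · exact hPu h0
  · refine hPu (hs v hv ?_)
    by_contra hPv
    exact hm v (mem_sep.2 ⟨hv, hPv⟩) (by simp)

theorem omg_least {P : M → Prop} [h : D0 (fun v : Fin 1 → M => P (v 0))] {x : M}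
    (hx : x ∈ (omg : M)) (hP : P x) : ∃ u, u ∈ (omg : M) ∧ P u ∧ ∀ v, v ∈ u → ¬ P v := by
  obtain ⟨u, hu, hm⟩ := regularity' (sep omg P) (mem_sep.2 ⟨hx, hP⟩)
  obtain ⟨hu, hPu⟩ := mem_sep.1 hu
  exact ⟨u, hu, hPu, fun v hv hPv => hm v (mem_sep.2 ⟨mem_omg_of_mem hu hv, hPv⟩) hv⟩

@[simp] theorem sc_inj {x y : M} : sc x = sc y ↔ x = y := by
  refine ⟨fun h => ?_, fun h => by rw [h]⟩
  have h1 : x ∈ sc y := by rw [← h]; simp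
  have h2 : y ∈ sc x := by rw [h]; simp
  rcases mem_sc.1 h1 with h1 | h1
  · rcases mem_sc.1 h2 with h2 | h2
    · exact absurd h1 (mem_asymm h2)
    · exact h2.symm
  · exact h1

@[simp] theorem sc_ne_emp {x : M} : sc x ≠ emp := fun h => not_mem_emp (x := x) (by rw [← h]; simp)

@[simp] theorem emp_ne_sc {x : M} : emp ≠ sc x := fun h => sc_ne_emp h.symm

theorem un_mem_omg {x y : M} (hx : x ∈ (omg : M)) (hy : y ∈ (omg : M)) : un x y ∈ (omg : M) := by
  rcases omg_compare hx hy with h | rfl | h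
  · rw [show un x y = y from ext fun u => by simpa using omg_trans hy h]; exact hy
  · rw [show un x x = x from ext fun u => by simp]; exact hy
  · rw [show un x y = x from ext fun u => by simpa using omg_trans hx h]; exact hx

theorem sub_of_mem_omg {x y : M} (hx : x ∈ (omg : M)) (hy : y ∈ x) : Sub y x :=
  fun _ => omg_trans hx hy

theorem mem_or_eq_of_sub {x y : M} (hx : x ∈ (omg : M)) (hy : y ∈ (omg : M)) (h : Sub x y) :
    x ∈ y ∨ x = y := by
  rcases omg_compare hx hy with h1 | h1 | h1
  · exact Or.inl h1
  · exact Or.inr h1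
  · exact absurd (h y h1) (mem_irrefl _)

/-! ## Finite sets -/

/-- All quantifiers are bounded in this form, which shows that being a function is Δ₀. -/
theorem fun_iff {f X Y : M} : Fun f X Y ↔
    (∀ p, p ∈ f → ∃ x, x ∈ X ∧ ∃ y, y ∈ Y ∧ p = op x y) ∧
      ∀ x, x ∈ X → ∃ y, y ∈ Y ∧ op x y ∈ f ∧ ∀ z, z ∈ Y → op x z ∈ f → z = y := by
  simp only [Fun, isOpair_iff, pairMem_iff]
  refine ⟨fun ⟨h1, h2⟩ => ⟨fun p hp => ?_, fun x hx => ?_⟩, fun ⟨h1, h2⟩ =>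
    ⟨fun p hp => ?_, fun x hx => ?_⟩⟩
  · obtain ⟨x, y, ⟨hx, hy⟩, rfl⟩ := h1 p hp
    exact ⟨x, hx, y, hy, rfl⟩
  · obtain ⟨y, hy, h⟩ := h2 x hx
    obtain ⟨x', y', ⟨hx', hy'⟩, he⟩ := h1 _ hy
    rw [op_inj] at he
    exact ⟨y, he.2 ▸ hy', hy, fun z _ => h z⟩
  · obtain ⟨x, hx, y, hy, rfl⟩ := h1 p hp
    exact ⟨x, y, ⟨hx, hy⟩, rfl⟩
  · obtain ⟨y, hy, hxy, h⟩ := h2 x hx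
    refine ⟨y, hxy, fun z hz => h z ?_ hz⟩
    obtain ⟨x', _, y', hy', he⟩ := h1 _ hz
    rw [op_inj] at he
    exact he.2 ▸ hy'

instance D0.func (f g h : (Fin n → M) → M) [Tm f] [Tm g] [Tm h] :
    D0 (fun v => Fun (f v) (g v) (h v)) := by
  simp only [fun_iff]; infer_instance

theorem fin_emp : Fin' (emp : M) :=
  ⟨emp, emp, isNat_emp, by simp [Bij, Fun]⟩

theorem fin_ins {x y : M} (h : Fin' x) : Fin' (ins x y) := by
  by_cases hy : y ∈ x
  · rwa [show ins x y = x from ext fun u => by simp; rintro rfl; exact hy]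
  obtain ⟨k, f, hk, ⟨h1, h2⟩, h3⟩ := h
  refine ⟨sc k, ins f (op k y), hk.sc, ⟨?_, ?_⟩, ?_⟩
  · intro p hp
    simp only [isOpair_iff] at h1 ⊢
    rcases mem_ins.1 hp with hp | rfl
    · obtain ⟨u, v, ⟨hu, hv⟩, rfl⟩ := h1 p hp
      exact ⟨u, v, by simp [hu, hv], rfl⟩
    · exact ⟨k, y, by simp, rfl⟩
  all_goals simp only [pairMem_iff, isOpair_iff, mem_ins, mem_sc, op_inj] at *
  · rintro u (hu | rfl)
    · obtain ⟨v, hv, hm⟩ := h2 u hu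
      refine ⟨v, Or.inl hv, fun z hz => ?_⟩
      rcases hz with hz | ⟨rfl, rfl⟩
      · exact hm z hz
      · exact absurd hu (mem_irrefl _)
    · refine ⟨y, by simp, fun z hz => ?_⟩
      rcases hz with hz | ⟨-, rfl⟩
      · obtain ⟨a, b, ⟨ha, hb⟩, he⟩ := h1 _ hz
        rw [op_inj] at he
        exact absurd (he.1 ▸ ha) (mem_irrefl _)
      · rfl
  · rintro v (hv | rfl)
    · obtain ⟨u, hu, hm⟩ := h3 v hv
      refine ⟨u, Or.inl hu, fun z hz => ?_⟩
      rcases hz with hz | ⟨rfl, rfl⟩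
      · exact hm z hz
      · exact absurd hv hy
    · refine ⟨k, by simp, fun z hz => ?_⟩
      rcases hz with hz | ⟨rfl, -⟩
      · obtain ⟨a, b, ⟨ha, hb⟩, he⟩ := h1 _ hz
        rw [op_inj] at he
        exact absurd (he.2 ▸ hb) hy
      · rfl

/-- The set of finite subsets of `x`. -/
noncomputable def Pf (x : M) : M := (CModel.finPow x).choose

theorem mem_Pf {x z : M} : z ∈ Pf x ↔ Sub z x ∧ Fin' z := (CModel.finPow x).choose_spec z

theorem emp_mem_Pf {A : M} : emp ∈ Pf A := mem_Pf.2 ⟨fun _ hu => absurd hu not_mem_emp, fin_emp⟩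

theorem ins_mem_Pf {A x y : M} (hx : x ∈ Pf A) (hy : y ∈ A) : ins x y ∈ Pf A := by
  rw [mem_Pf] at *
  refine ⟨fun u hu => ?_, fin_ins hx.2⟩
  rcases mem_ins.1 hu with hu | rfl
  · exact hx.1 u hu
  · exact hy

theorem sub_of_mem_Pf {A x : M} (hx : x ∈ Pf A) {u : M} (hu : u ∈ x) : u ∈ A :=
  (mem_Pf.1 hx).1 u hu

/-- Induction on ω along an enumeration `f` of `x`: the elements listed before stage j form a subset
that grows by one element at each stage. -/
theorem fin_induction {A : M} {P : M → Prop} [h : D0 (fun v : Fin 1 → M => P (v 0))] (h0 : P emp)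
    (hs : ∀ x, x ∈ Pf A → ∀ y, y ∈ A → P x → P (ins x y)) : ∀ x, x ∈ Pf A → P x := by
  intro x hx
  obtain ⟨hxA, k, f, hk, ⟨h1, h2⟩, h3⟩ := mem_Pf.1 hx
  -- Puts into the context the Δ₀ instances for `P` applied to a term, here a separated subset of
  -- `x`.
  have hP := fun {n : ℕ} (t : (Fin n → M) → M) [Tm t] => D0.comp P t
  simp only [pairMem_iff, isOpair_iff] at h1 h2 h3
  have key : ∀ j, j ∈ (omg : M) → j ∈ sc k →
      sep x (fun y => ∃ i, i ∈ j ∧ op i y ∈ f) ∈ Pf A ∧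
        P (sep x (fun y => ∃ i, i ∈ j ∧ op i y ∈ f)) := by
    refine omg_induction ?_ ?_
    · intro _
      rw [show sep x (fun y => ∃ i, i ∈ emp ∧ op i y ∈ f) = emp from ext fun u => by simp]
      exact ⟨emp_mem_Pf, h0⟩
    · intro j hj ih hjk
      have hjk' : j ∈ k := by
        rcases mem_sc.1 hjk with h | rfl
        · exact omg_trans (mem_omg.2 hk) h (by simp)
        · simp
      obtain ⟨h4, h5⟩ := ih (by simp [hjk'])
      obtain ⟨y, hy, hm⟩ := h2 j hjk'
      have hyx : y ∈ x := by
        obtain ⟨a, b, ⟨ha, hb⟩, he⟩ := h1 _ hy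
        exact (op_inj.1 he).2 ▸ hb
      rw [show sep x (fun y => ∃ i, i ∈ sc j ∧ op i y ∈ f) =
        ins (sep x (fun y => ∃ i, i ∈ j ∧ op i y ∈ f)) y from ext fun u => by simp; grind]
      exact ⟨ins_mem_Pf h4 (hxA _ hyx), hs _ h4 _ (hxA _ hyx) h5⟩
  have := (key k (mem_omg.2 hk) (by simp)).2
  rwa [show sep x (fun y => ∃ i, i ∈ k ∧ op i y ∈ f) = x from ext fun u => by
    simp only [mem_sep, and_iff_left_iff_imp]
    intro hu
    obtain ⟨i, hi, -⟩ := h3 u hu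
    obtain ⟨a, b, ⟨ha, hb⟩, he⟩ := h1 _ hi
    exact ⟨i, (op_inj.1 he).1 ▸ ha, hi⟩] at this

theorem un_emp {x : M} : un x emp = x := ext fun u => by simp

theorem un_ins {x y z : M} : un x (ins y z) = ins (un x y) z := ext fun u => by simp [or_assoc]

theorem un_mem_Pf {A x y : M} (hx : x ∈ Pf A) (hy : y ∈ Pf A) : un x y ∈ Pf A := by
  refine fin_induction (P := fun y => un x y ∈ Pf A) ?_ (fun _ _ z hz hy => ?_) y hy
  · rwa [un_emp]
  · rw [un_ins]; exact ins_mem_Pf hy hz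

/-- Induction on `x` with `z` fixed, for the intersection of the two. -/
theorem mem_Pf_of_sub {A x z : M} (hx : x ∈ Pf A) (hz : Sub z x) : z ∈ Pf A := by
  have := fin_induction (P := fun x => sep z (fun u => u ∈ x) ∈ Pf A) ?_ (fun y _ w hw hy => ?_) x hx
  · rwa [show sep z (fun u => u ∈ x) = z from ext fun u => by simpa using hz u] at this
  · rw [show sep z (fun u => u ∈ emp) = emp from ext fun u => by simp]; exact emp_mem_Pf
  · by_cases hwz : w ∈ z
    · rw [show sep z (fun u => u ∈ ins y w) = ins (sep z (fun u => u ∈ y)) w from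
        ext fun u => by simp; grind]
      exact ins_mem_Pf hy hw
    · rwa [show sep z (fun u => u ∈ ins y w) = sep z (fun u => u ∈ y) from
        ext fun u => by simp; grind]

theorem ins_emp {x : M} : ins emp x = sg x := ext fun u => by simp

theorem sg_mem_Pf {A x : M} (hx : x ∈ A) : sg x ∈ Pf A := ins_emp (x := x) ▸ ins_mem_Pf emp_mem_Pf hx

theorem ins_sg {x y : M} : ins (sg x) y = pr x y := ext fun u => by simp

theorem pr_mem_Pf {A x y : M} (hx : x ∈ A) (hy : y ∈ A) : pr x y ∈ Pf A :=
  ins_sg (x := x) ▸ ins_mem_Pf (sg_mem_Pf hx) hy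

/-! ## Products and functions -/

/-- The product of two sets. -/
noncomputable def prod (A B : M) : M :=
  sep (Pf (Pf (un A B))) fun p => ∃ x, x ∈ A ∧ ∃ y, y ∈ B ∧ p = op x y

/-- A Kuratowski pair is a finite set of finite sets, so two applications of Finite Powerset bound
the product without the full powerset. -/
theorem mem_prod {A B p : M} : p ∈ prod A B ↔ ∃ x, x ∈ A ∧ ∃ y, y ∈ B ∧ p = op x y := by
  simp only [prod, mem_sep, and_iff_right_iff_imp]
  rintro ⟨x, hx, y, hy, rfl⟩
  exact pr_mem_Pf (sg_mem_Pf (by simp [hx])) (pr_mem_Pf (by simp [hx]) (by simp [hy]))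

@[simp] theorem op_mem_prod {A B x y : M} : op x y ∈ prod A B ↔ x ∈ A ∧ y ∈ B := by
  simp only [mem_prod, op_inj]; grind

/-- The value of the function `f` at `x`. -/
noncomputable def ap (f x : M) : M := bU (sep (bU (bU f)) fun y => op x y ∈ f)

instance Tm.ap (f g : (Fin n → M) → M) [Tm f] [Tm g] : Tm (fun v => ap (f v) (g v)) := by
  unfold WeakSet.ap; infer_instance

theorem snd_mem_bU {x y f : M} (h : op x y ∈ f) : y ∈ bU (bU f) := by
  simp only [mem_bU]
  exact ⟨pr x y, ⟨op x y, h, by simp [op]⟩, by simp⟩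

theorem ap_eq {f x y : M} (h : op x y ∈ f) (hu : ∀ z, op x z ∈ f → z = y) : ap f x = y := by
  rw [ap, show sep (bU (bU f)) (fun y => op x y ∈ f) = sg y from ext fun u => by
    rw [mem_sep, mem_sg]
    exact ⟨fun h => hu u h.2, fun h' => by rw [h']; exact ⟨snd_mem_bU h, h⟩⟩]
  exact ext fun u => by simp

theorem Fun.ap_mem {f X Y x : M} (hf : Fun f X Y) (hx : x ∈ X) :
    op x (ap f x) ∈ f ∧ ap f x ∈ Y := by
  obtain ⟨h1, h2⟩ := fun_iff.1 hf
  obtain ⟨y, hy, hxy, hu⟩ := h2 x hx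
  rw [ap_eq hxy fun z hz => hu z (by
    obtain ⟨a, _, b, hb, he⟩ := h1 _ hz
    exact (op_inj.1 he).2 ▸ hb) hz]
  exact ⟨hxy, hy⟩

theorem Fun.mem_iff {f X Y : M} (hf : Fun f X Y) {x y : M} : op x y ∈ f ↔ x ∈ X ∧ y = ap f x := by
  obtain ⟨h1, h2⟩ := fun_iff.1 hf
  refine ⟨fun h => ?_, fun ⟨h, h'⟩ => h' ▸ (hf.ap_mem h).1⟩
  obtain ⟨a, ha, b, hb, he⟩ := h1 _ h
  obtain ⟨rfl, rfl⟩ := op_inj.1 he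
  obtain ⟨c, hc, hac, hu⟩ := h2 _ ha
  exact ⟨ha, (hu _ hb h).trans (hu _ (hf.ap_mem ha).2 (hf.ap_mem ha).1).symm⟩

/-! ## Inductive definitions -/

/-- A fixed point of the operator given by the initial elements `A` and the rules `C`. -/
noncomputable def fixp (D : M) (A : M → Prop) (C : M → M → M → Prop) : M :=
  sep D fun x => ∃ S, S ∈ Pf D ∧ x ∈ S ∧ ∀ y, y ∈ S → A y ∨ ∃ p, p ∈ S ∧ ∃ q, q ∈ S ∧ C y p q

theorem mem_fixp' {D : M} {A : M → Prop} {C : M → M → M → Prop}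
    [D0 (fun v : Fin 1 → M => A (v 0))] [D0 (fun v : Fin 3 → M => C (v 0) (v 1) (v 2))] {x : M} :
    x ∈ fixp D A C ↔ x ∈ D ∧ ∃ S, S ∈ Pf D ∧ x ∈ S ∧
      ∀ y, y ∈ S → A y ∨ ∃ p, p ∈ S ∧ ∃ q, q ∈ S ∧ C y p q := by
  have hA := fun {n : ℕ} (t : (Fin n → M) → M) [Tm t] => D0.comp A t
  have hC := fun {n : ℕ} (s t u : (Fin n → M) → M) [Tm s] [Tm t] [Tm u] => D0.comp₃ C s t u
  rw [fixp, mem_sep]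

/-- A witness is a finite set each of whose elements is initial or follows by a rule from elements
of the same set; two witnesses together with a new conclusion form a witness. Circular witnesses are
not excluded, so only the fixed point equation is claimed. Leastness or uniqueness has to come from
the particular rules. -/
theorem mem_fixp {D : M} {A : M → Prop} {C : M → M → M → Prop}
    [D0 (fun v : Fin 1 → M => A (v 0))] [D0 (fun v : Fin 3 → M => C (v 0) (v 1) (v 2))] {x : M} :
    x ∈ fixp D A C ↔ x ∈ D ∧ (A x ∨ ∃ p, p ∈ fixp D A C ∧ ∃ q, q ∈ fixp D A C ∧ C x p q) := by
  refine ⟨fun h => ?_, fun ⟨hx, h⟩ => ?_⟩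
  · obtain ⟨hx, S, hS, hxS, hC⟩ := mem_fixp'.1 h
    have hsub : ∀ y, y ∈ S → y ∈ fixp D A C :=
      fun y hy => mem_fixp'.2 ⟨sub_of_mem_Pf hS hy, S, hS, hy, hC⟩
    refine ⟨hx, (hC x hxS).imp_right ?_⟩
    rintro ⟨p, hp, q, hq, h⟩
    exact ⟨p, hsub p hp, q, hsub q hq, h⟩
  · rcases h with h | ⟨p, hp, q, hq, h⟩
    · exact mem_fixp'.2 ⟨hx, sg x, sg_mem_Pf hx, by simp, fun y hy => by
        rw [mem_sg.1 hy]; exact Or.inl h⟩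
    · obtain ⟨-, S, hS, hpS, hC⟩ := mem_fixp'.1 hp
      obtain ⟨-, T, hT, hqT, hC'⟩ := mem_fixp'.1 hq
      refine mem_fixp'.2 ⟨hx, ins (un S T) x, ins_mem_Pf (un_mem_Pf hS hT) hx, by simp, ?_⟩
      intro y hy
      simp only [mem_ins, mem_un] at hy ⊢
      rcases hy with (hy | hy) | rfl
      · have := hC y hy; grind
      · have := hC' y hy; grind
      · exact Or.inr ⟨p, by simp [hpS], q, by simp [hqT], h⟩

end

section

variable {M : Type} [setLang.Structure M] [CModel M] {n : ℕ}

theorem exists_collapse (X R : M) (hR : ∀ p, p ∈ R → ∃ u, u ∈ X ∧ ∃ v, v ∈ X ∧ p = op u v)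
    (hwf : ∀ Y y : M, Sub Y X → y ∈ Y → ∃ u, u ∈ Y ∧ ∀ v, v ∈ Y → ¬ op v u ∈ R) :
    ∃ Y π : M, Fun π X Y ∧
      ∀ u, u ∈ X → ∀ z, z ∈ ap π u ↔ ∃ v, v ∈ X ∧ op v u ∈ R ∧ z = ap π v := by
  obtain ⟨Y, π, ⟨-, hπ⟩, h⟩ := CModel.beta X R ⟨fun p hp => by
    obtain ⟨u, hu, v, hv, rfl⟩ := hR p hp
    exact ⟨u, v, ⟨hu, hv⟩, isOpair_iff.2 rfl⟩, fun Y ⟨hY, hne⟩ => by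
      push Not at hne
      obtain ⟨y, hy⟩ := hne
      simpa only [pairMem_iff] using hwf Y y hY hy⟩
  refine ⟨Y, π, hπ, fun u hu z => ?_⟩
  obtain ⟨y, hy, hz⟩ := h u hu
  rw [pairMem_iff, hπ.mem_iff] at hy
  rw [← hy.2, hz]
  simp only [pairMem_iff, hπ.mem_iff]
  grind

/-! ## Hereditarily finite sets -/

theorem mem_Pf_omg_of_mem_omg : ∀ k : M, k ∈ (omg : M) → k ∈ Pf (omg : M) :=
  omg_induction emp_mem_Pf fun _ hk h => ins_mem_Pf h hk

theorem exists_bound : ∀ b : M, b ∈ Pf (omg : M) → ∃ k, k ∈ (omg : M) ∧ ∀ i, i ∈ b → i ∈ k := by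
  refine fin_induction ⟨emp, emp_mem_omg, fun i hi => hi⟩ ?_
  rintro b hb y hy ⟨k, hk, h⟩
  refine ⟨un k (sc y), un_mem_omg hk (sc_mem_omg hy), fun i hi => ?_⟩
  simp at hi ⊢
  grind

theorem exists_least_not_mem {b : M} (hb : b ∈ Pf (omg : M)) :
    ∃ k, k ∈ (omg : M) ∧ ¬ k ∈ b ∧ ∀ i, i ∈ k → i ∈ b := by
  obtain ⟨k, hk, h⟩ := exists_bound b hb
  obtain ⟨u, hu, h1, h2⟩ := omg_least (P := fun k => ¬ k ∈ b) hk fun h' => mem_irrefl _ (h k h')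
  exact ⟨u, hu, h1, fun i hi => not_not.1 (h2 i hi)⟩

/-- The binary representations of the natural numbers, as finite sets of natural numbers. -/
noncomputable def binary : M :=
  fixp (prod omg (Pf omg)) (fun p => p = op emp emp) fun p q _ =>
    ∃ n, n ∈ (omg : M) ∧ ∃ b, b ∈ Pf (omg : M) ∧ ∃ k, k ∈ (omg : M) ∧ q = op n b ∧
      p = op (sc n) (ins (sep b fun i => ¬ i ∈ k) k) ∧ ¬ k ∈ b ∧ ∀ i, i ∈ k → i ∈ b

/-- The rule is the binary increment: the least absent digit k is set and all digits below it are
cleared. -/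
theorem mem_binary {m c : M} : op m c ∈ (binary : M) ↔ (m = emp ∧ c = emp) ∨
    ∃ n, n ∈ (omg : M) ∧ ∃ b, b ∈ Pf (omg : M) ∧ ∃ k, k ∈ (omg : M) ∧ op n b ∈ (binary : M) ∧
      (m = sc n ∧ c = ins (sep b fun i => ¬ i ∈ k) k) ∧ ¬ k ∈ b ∧ ∀ i, i ∈ k → i ∈ b := by
  have hstep : ∀ {b k : M}, b ∈ Pf (omg : M) → k ∈ (omg : M) →
      ins (sep b fun i => ¬ i ∈ k) k ∈ Pf (omg : M) := fun hb hk =>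
    ins_mem_Pf (mem_Pf_of_sub hb fun u hu => (mem_sep.1 hu).1) hk
  refine ⟨fun h => ?_, fun h => ?_⟩
  · rw [binary, mem_fixp] at h
    obtain ⟨-, h | ⟨p, hp, q, -, n, hn, b, hb, k, hk, rfl, h1, h2⟩⟩ := h
    · exact Or.inl (op_inj.1 h)
    · exact Or.inr ⟨n, hn, b, hb, k, hk, hp, op_inj.1 h1, h2⟩
  · rw [binary, mem_fixp]
    rcases h with ⟨rfl, rfl⟩ | ⟨n, hn, b, hb, k, hk, h1, ⟨rfl, rfl⟩, h2⟩
    · simp [emp_mem_omg, emp_mem_Pf]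
    · refine ⟨op_mem_prod.2 ⟨sc_mem_omg hn, hstep hb hk⟩, Or.inr
        ⟨_, h1, _, h1, n, hn, b, hb, k, hk, rfl, rfl, h2⟩⟩

theorem binary_total : ∀ n : M, n ∈ (omg : M) → ∃ b, b ∈ Pf (omg : M) ∧ op n b ∈ (binary : M) := by
  refine omg_induction ⟨emp, emp_mem_Pf, mem_binary.2 (Or.inl ⟨rfl, rfl⟩)⟩ ?_
  rintro n hn ⟨b, hb, h⟩
  obtain ⟨k, hk, h1⟩ := exists_least_not_mem hb
  exact ⟨ins (sep b fun i => ¬ i ∈ k) k,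
    ins_mem_Pf (mem_Pf_of_sub hb fun u hu => (mem_sep.1 hu).1) hk,
    mem_binary.2 (Or.inr ⟨n, hn, b, hb, k, hk, h, ⟨rfl, rfl⟩, h1⟩)⟩

theorem binary_unique : ∀ n : M, n ∈ (omg : M) → ∀ b, b ∈ Pf (omg : M) → ∀ c, c ∈ Pf (omg : M) →
    op n b ∈ (binary : M) → op n c ∈ (binary : M) → b = c := by
  refine omg_induction ?_ ?_
  · intro b _ c _ h h'
    rw [mem_binary] at h h'
    simp only [emp_ne_sc, false_and, and_false, exists_false, or_false] at h h'
    rw [h.2, h'.2]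
  · intro n hn ih b _ c _ h h'
    rw [mem_binary] at h h'
    simp only [sc_ne_emp, false_and, false_or, sc_inj] at h h'
    obtain ⟨_, -, b', hb', k, hk, h1, ⟨rfl, rfl⟩, h2, h3⟩ := h
    obtain ⟨_, -, c', hc', l, hl, h1', ⟨rfl, rfl⟩, h2', h3'⟩ := h'
    obtain rfl := ih b' hb' c' hc' h1 h1'
    have : k = l := by
      rcases omg_compare hk hl with h | h | h
      · exact absurd (h3' _ h) h2
      · exact h
      · exact absurd (h3 _ h) h2'
    rw [this]

/-- This makes Ackermann's relation a part of ∈ on ω, hence well founded. The new digit k is at most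
n because all digits below it are present and, inductively, lie below n. -/
theorem binary_lt : ∀ n : M, n ∈ (omg : M) → ∀ b, b ∈ Pf (omg : M) → op n b ∈ (binary : M) →
    ∀ i, i ∈ b → i ∈ n := by
  refine omg_induction ?_ ?_
  · intro b _ h
    rw [mem_binary] at h
    simp only [emp_ne_sc, false_and, and_false, exists_false, or_false] at h
    rw [h.2]; exact fun i hi => hi
  · intro n hn ih b _ h i hi
    rw [mem_binary] at h
    simp only [sc_ne_emp, false_and, false_or, sc_inj] at h
    obtain ⟨_, -, b', hb', k, hk, h1, ⟨rfl, rfl⟩, h2, h3⟩ := h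
    have := ih b' hb' h1
    rcases mem_ins.1 hi with hi | rfl
    · exact mem_sc.2 (Or.inl (this i (mem_sep.1 hi).1))
    · exact mem_sc.2 (mem_or_eq_of_sub hk hn fun j hj => this j (h3 j hj))

/-- Every finite set is reached by counting. Starting from a representation `s` with no digit below
k, each pattern `t` of the digits below k occurs later on; induction on k. -/
theorem binary_surj : ∀ b : M, b ∈ Pf (omg : M) → ∃ n, n ∈ (omg : M) ∧ op n b ∈ (binary : M) := by
  have key : ∀ k : M, k ∈ (omg : M) → ∀ s, s ∈ Pf (omg : M) →
      (∃ n, n ∈ (omg : M) ∧ op n s ∈ (binary : M)) → (∀ i, i ∈ s → ¬ i ∈ k) →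
      ∀ t, t ∈ Pf (omg : M) → (∀ i, i ∈ t → i ∈ k) →
        ∃ n, n ∈ (omg : M) ∧ op n (un s t) ∈ (binary : M) := by
    refine omg_induction ?_ ?_
    · intro s _ h _ t _ ht
      rwa [show un s t = s from ext fun u => by
        have := ht u
        simp only [not_mem_emp, imp_false] at this
        simp [this] ]
    · intro k hk ih s hs h hsk t ht htk
      have hsk' : ∀ i, i ∈ s → ¬ i ∈ k := fun i hi hik => hsk i hi (by simp [hik])
      have hks : ¬ k ∈ s := fun h => hsk k h (by simp)
      by_cases hkt : k ∈ t
      -- Count until all digits below k are set; one more increment carries into k and clears them,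
      -- after which the induction hypothesis supplies the remaining digits of `t`.
      · obtain ⟨n, hn, h1⟩ := ih s hs h hsk' k (mem_Pf_omg_of_mem_omg k hk) fun i hi => hi
        have h2 : op (sc n) (ins s k) ∈ (binary : M) := by
          refine mem_binary.2 (Or.inr ⟨n, hn, _, un_mem_Pf hs (mem_Pf_omg_of_mem_omg k hk), k, hk,
            h1, ⟨rfl, ext fun u => ?_⟩, ?_, ?_⟩)
          · simp; grind
          · simp [hks, mem_irrefl]
          · intro i hi; simp [hi]
        have h3 := ih (ins s k) (ins_mem_Pf hs hk) ⟨_, sc_mem_omg hn, h2⟩ (fun i hi => by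
            rcases mem_ins.1 hi with hi | rfl
            · exact hsk' i hi
            · exact mem_irrefl _)
          (sep t fun i => i ∈ k) (mem_Pf_of_sub ht fun u hu => (mem_sep.1 hu).1)
          (fun i hi => (mem_sep.1 hi).2)
        rwa [show un (ins s k) (sep t fun i => i ∈ k) = un s t from ext fun u => by
          have := htk u
          simp at this ⊢; grind] at h3
      · refine ih s hs h hsk' t ht fun i hi => ?_
        rcases mem_sc.1 (htk i hi) with h | rfl
        · exact h
        · exact absurd hi hkt
  intro b hb
  obtain ⟨k, hk, h⟩ := exists_bound b hb
  have := key k hk emp emp_mem_Pf ⟨emp, emp_mem_omg, mem_binary.2 (Or.inl ⟨rfl, rfl⟩)⟩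
    (fun i hi => absurd hi not_mem_emp) b hb h
  rwa [show un emp b = b from ext fun u => by simp] at this

/-- The range of the collapse of Ackermann's relation. Adjoining the value at m to the value at n
corresponds to adding the digit m to n, and the resulting digit set represents some number by
`binary_surj`. -/
theorem exists_hereditarilyFinite : ∃ V : M, (∀ x, x ∈ V → ∀ y, y ∈ x → y ∈ V) ∧ emp ∈ V ∧
    ∀ x, x ∈ V → ∀ y, y ∈ V → ins x y ∈ V := by
  obtain ⟨Y, π, hπ, h⟩ := exists_collapse (omg : M)
    (sep (prod omg omg) fun p => ∃ m, m ∈ (omg : M) ∧ ∃ n, n ∈ (omg : M) ∧ ∃ b, b ∈ Pf (omg : M) ∧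
      p = op m n ∧ op n b ∈ (binary : M) ∧ m ∈ b)
    (fun p hp => mem_prod.1 (mem_sep.1 hp).1)
    (fun Y y hY hy => by
      obtain ⟨u, hu, hm⟩ := regularity' Y hy
      refine ⟨u, hu, fun v hv hvu => ?_⟩
      obtain ⟨m, hm', n, hn, b, hb, he, h1, h2⟩ := (mem_sep.1 hvu).2
      obtain ⟨rfl, rfl⟩ := op_inj.1 he
      exact hm _ hv (binary_lt _ hn _ hb h1 _ h2))
  have h' : ∀ n, n ∈ (omg : M) → ∀ b, b ∈ Pf (omg : M) → op n b ∈ (binary : M) →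
      ∀ z, z ∈ ap π n ↔ ∃ v, v ∈ b ∧ z = ap π v := by
    intro n hn b hb hnb z
    rw [h n hn]
    simp only [mem_sep, op_mem_prod, op_inj]
    constructor
    · rintro ⟨v, hv, ⟨-, m, -, n', -, c, hc, ⟨rfl, rfl⟩, h1, h2⟩, rfl⟩
      exact ⟨v, binary_unique _ hn _ hb _ hc hnb h1 ▸ h2, rfl⟩
    · rintro ⟨v, hv, rfl⟩
      have hv' := sub_of_mem_Pf hb hv
      exact ⟨v, hv', ⟨⟨hv', hn⟩, v, hv', n, hn, b, hb, ⟨rfl, rfl⟩, hnb, hv⟩, rfl⟩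
  refine ⟨sep Y fun y => ∃ n, n ∈ (omg : M) ∧ y = ap π n, ?_, ?_, ?_⟩
  · intro x hx y hy
    obtain ⟨-, n, hn, rfl⟩ := mem_sep.1 hx
    obtain ⟨v, hv, -, rfl⟩ := (h n hn y).1 hy
    exact mem_sep.2 ⟨(hπ.ap_mem hv).2, v, hv, rfl⟩
  · have h0 : ap π emp = emp := ext fun u => by
      simp [h' emp emp_mem_omg emp emp_mem_Pf (mem_binary.2 (Or.inl ⟨rfl, rfl⟩))]
    exact mem_sep.2 ⟨h0 ▸ (hπ.ap_mem emp_mem_omg).2, emp, emp_mem_omg, h0.symm⟩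
  · intro x hx y hy
    obtain ⟨-, n, hn, rfl⟩ := mem_sep.1 hx
    obtain ⟨-, m, hm, rfl⟩ := mem_sep.1 hy
    obtain ⟨b, hb, hnb⟩ := binary_total n hn
    obtain ⟨l, hl, hlb⟩ := binary_surj (ins b m) (ins_mem_Pf hb hm)
    rw [show ins (ap π n) (ap π m) = ap π l from ext fun u => by
      rw [mem_ins, h' n hn b hb hnb, h' l hl _ (ins_mem_Pf hb hm) hlb]
      simp only [mem_ins]; grind]
    exact mem_sep.2 ⟨(hπ.ap_mem hl).2, l, hl, rfl⟩

/-- A set of hereditarily finite sets with good closure properties. -/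
noncomputable def VV : M := (exists_hereditarilyFinite (M := M)).choose

theorem VV_trans {x y : M} (hx : x ∈ (VV : M)) (hy : y ∈ x) : y ∈ (VV : M) :=
  exists_hereditarilyFinite.choose_spec.1 x hx y hy

theorem emp_mem_VV : emp ∈ (VV : M) := exists_hereditarilyFinite.choose_spec.2.1

theorem ins_mem_VV {x y : M} (hx : x ∈ (VV : M)) (hy : y ∈ (VV : M)) : ins x y ∈ (VV : M) :=
  exists_hereditarilyFinite.choose_spec.2.2 x hx y hy

theorem sg_mem_VV {x : M} (hx : x ∈ (VV : M)) : sg x ∈ (VV : M) :=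
  ins_emp (x := x) ▸ ins_mem_VV emp_mem_VV hx

theorem pr_mem_VV {x y : M} (hx : x ∈ (VV : M)) (hy : y ∈ (VV : M)) : pr x y ∈ (VV : M) :=
  ins_sg (x := x) ▸ ins_mem_VV (sg_mem_VV hx) hy

theorem op_mem_VV {x y : M} (hx : x ∈ (VV : M)) (hy : y ∈ (VV : M)) : op x y ∈ (VV : M) :=
  pr_mem_VV (sg_mem_VV hx) (pr_mem_VV hx hy)

theorem mem_VV_of_mem_omg : ∀ x : M, x ∈ (omg : M) → x ∈ (VV : M) :=
  omg_induction emp_mem_VV fun _ _ h => ins_mem_VV h h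

/-! ## Iteration of a game operator -/

/-- Recursion on levels is simulated by collapsing a relation on ω × (X ∪ {t, f}). At each level
every position of X receives the same value as one of the markers t, f, and W collects those
agreeing with t. -/
theorem exists_levels (X : M) (R : M → M → Prop) [D0 (fun v : Fin 2 → M => R (v 0) (v 1))] :
    ∃ W : M, (∀ x, x ∈ X → ¬ op emp x ∈ W) ∧ ∀ n, n ∈ (omg : M) → ∀ x, x ∈ X →
      (op (sc n) x ∈ W ↔ ∃ y, y ∈ X ∧ R y x ∧ ¬ op n y ∈ W) := by
  have hR := fun {n : ℕ} (s t : (Fin n → M) → M) [Tm s] [Tm t] => D0.comp₂ R s t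
  obtain ⟨t, f, htX, hfX, htf⟩ : ∃ t f : M, ¬ t ∈ X ∧ ¬ f ∈ X ∧ t ≠ f := by
    -- Regularity ensures that `X` and {X} are two distinct sets outside `X`.
    refine ⟨X, sg X, mem_irrefl X, fun h => mem_asymm h (by simp), fun h => mem_irrefl X ?_⟩
    have : X ∈ sg X := by simp
    rwa [← h] at this
  let Z : M := ins (ins X t) f
  have htZ : t ∈ Z := by simp [Z]
  have hfZ : f ∈ Z := by simp [Z]
  have hXZ : ∀ {x}, x ∈ X → x ∈ Z := fun h => by simp [Z, h]
  -- The edges are chosen so that π(0,t) = {∅} and π(0,f) = π(0,x) = ∅, while π(n+1,t) = {π(n,t),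
  -- π(n,f)}, π(n+1,f) = {π(n,t)} and π(n+1,x) = {π(n,t)} ∪ {π(n,y) : y ∈ X, R y x}.
  let E : M := sep (prod (prod omg Z) (prod omg Z)) fun p => ∃ m, m ∈ (omg : M) ∧ ∃ y, y ∈ Z ∧
    ∃ n, n ∈ (omg : M) ∧ ∃ x, x ∈ Z ∧ p = op (op m y) (op n x) ∧
      ((n = sc m ∧ (y = t ∨ (x = t ∧ y = f) ∨ (y ∈ X ∧ x ∈ X ∧ R y x))) ∨
        (n = emp ∧ m = emp ∧ x = t ∧ y = f))
  have hE : ∀ {m y n x}, op (op m y) (op n x) ∈ E ↔ (m ∈ (omg : M) ∧ y ∈ Z) ∧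
      (n ∈ (omg : M) ∧ x ∈ Z) ∧ ((n = sc m ∧ (y = t ∨ (x = t ∧ y = f) ∨ (y ∈ X ∧ x ∈ X ∧ R y x))) ∨
        (n = emp ∧ m = emp ∧ x = t ∧ y = f)) := by
    intro m y n x
    simp only [E, mem_sep, op_mem_prod, op_inj]
    grind
  obtain ⟨Y, π, -, hπ⟩ := exists_collapse (prod omg Z) E
    (fun p hp => mem_prod.1 (mem_sep.1 hp).1) (fun Y y hY hy => by
      obtain ⟨n, hn, x, hx, rfl⟩ := mem_prod.1 (hY y hy)
      -- Go to the lowest level meeting `Y`. The only edge inside a level runs from (0,f) to (0,t),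
      -- so if the point found is not minimal, then (0,f) is.
      obtain ⟨k, hk, ⟨z, hz, hkz⟩, hmin⟩ :=
        omg_least (P := fun k => ∃ z, z ∈ Z ∧ op k z ∈ Y) hn ⟨x, hx, hy⟩
      have hmin' : ∀ v, v ∈ Y → op v (op k z) ∈ E → ∃ y, v = op k y ∧ k = emp ∧ z = t ∧ y = f := by
        intro v hv hvE
        obtain ⟨m, hm, y, hy, rfl⟩ := mem_prod.1 (hY v hv)
        rcases (hE.1 hvE).2.2 with ⟨rfl, h⟩ | ⟨rfl, rfl, h1, h2⟩
        · exact absurd ⟨y, hy, hv⟩ (hmin m (by simp))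
        · exact ⟨y, rfl, rfl, h1, h2⟩
      by_cases h : ∃ v, v ∈ Y ∧ op v (op k z) ∈ E
      · obtain ⟨v, hv, hvE⟩ := h
        obtain ⟨y, rfl, rfl, rfl, rfl⟩ := hmin' v hv hvE
        refine ⟨_, hv, fun u hu huE => ?_⟩
        obtain ⟨m, hm, w, hw, rfl⟩ := mem_prod.1 (hY u hu)
        rcases (hE.1 huE).2.2 with ⟨h, _⟩ | ⟨_, _, h, _⟩
        · exact emp_ne_sc h
        · exact htf h.symm
      · exact ⟨_, hkz, fun v hv hvE => h ⟨v, hv, hvE⟩⟩)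
  have hv : ∀ {n x}, n ∈ (omg : M) → x ∈ Z → ∀ z, z ∈ ap π (op n x) ↔
      ∃ m, m ∈ (omg : M) ∧ ∃ y, y ∈ Z ∧ ((n = sc m ∧ (y = t ∨ (x = t ∧ y = f) ∨
        (y ∈ X ∧ x ∈ X ∧ R y x))) ∨ (n = emp ∧ m = emp ∧ x = t ∧ y = f)) ∧
        z = ap π (op m y) := by
    intro n x hn hx z
    rw [hπ _ (by simp [hn, hx])]
    constructor
    · rintro ⟨v, hv, h, rfl⟩
      obtain ⟨m, hm, y, hy, rfl⟩ := mem_prod.1 hv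
      exact ⟨m, hm, y, hy, (hE.1 h).2.2, rfl⟩
    · rintro ⟨m, hm, y, hy, h, rfl⟩
      exact ⟨_, by simp [hm, hy], hE.2 ⟨⟨hm, hy⟩, ⟨hn, hx⟩, h⟩, rfl⟩
  have ht0 : f ≠ t := htf.symm
  have v0t : ∀ z, z ∈ ap π (op emp t) ↔ z = ap π (op emp f) := fun z => by
    rw [hv emp_mem_omg htZ]; simp [hfZ, emp_mem_omg]
  have v0 : ∀ x, x ∈ Z → x ≠ t → ap π (op emp x) = emp := fun x hx hxt => ext fun z => by
    rw [hv emp_mem_omg hx]; simp [hxt]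
  have vst : ∀ n, n ∈ (omg : M) → ∀ z, z ∈ ap π (op (sc n) t) ↔
      z = ap π (op n t) ∨ z = ap π (op n f) := fun n hn z => by
    rw [hv (sc_mem_omg hn) htZ]
    simp only [sc_inj, sc_ne_emp, false_and, or_false, htX, and_false, true_and]
    grind
  have vsf : ∀ n, n ∈ (omg : M) → ∀ z, z ∈ ap π (op (sc n) f) ↔
      z = ap π (op n t) := fun n hn z => by
    rw [hv (sc_mem_omg hn) hfZ]
    simp only [sc_inj, sc_ne_emp, false_and, or_false, hfX, and_false, ht0]
    grind
  have vsX : ∀ n, n ∈ (omg : M) → ∀ x, x ∈ X → ∀ z, z ∈ ap π (op (sc n) x) ↔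
      z = ap π (op n t) ∨ ∃ y, y ∈ X ∧ R y x ∧ z = ap π (op n y) := fun n hn x hx z => by
    have hxt : x ≠ t := by rintro rfl; exact htX hx
    rw [hv (sc_mem_omg hn) (hXZ hx)]
    simp only [sc_inj, sc_ne_emp, false_and, or_false, hx, hxt, true_and, false_or]
    constructor
    · grind
    · rintro (rfl | ⟨y, hy, h, rfl⟩)
      · exact ⟨n, hn, t, htZ, ⟨rfl, Or.inl rfl⟩, rfl⟩
      · exact ⟨n, hn, y, hXZ hy, ⟨rfl, Or.inr ⟨hy, h⟩⟩, rfl⟩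
  -- The markers stay distinct because π(n,f) belongs to π(n+1,t) but not to π(n+1,f). A position
  -- takes the value of t exactly when one of its moves has the value of f one level below.
  have key : ∀ n, n ∈ (omg : M) → ap π (op n t) ≠ ap π (op n f) ∧
      ∀ x, x ∈ X → ap π (op n x) = ap π (op n t) ∨ ap π (op n x) = ap π (op n f) := by
    refine omg_induction ⟨fun h => ?_, fun x hx => Or.inr ?_⟩ ?_
    · rw [v0 f hfZ ht0] at h v0t
      have := (v0t emp).2 rfl
      rw [h] at this
      exact not_mem_emp this
    · rw [v0 f hfZ ht0, v0 x (hXZ hx) (by rintro rfl; exact htX hx)]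
    · rintro n hn ⟨h1, h2⟩
      refine ⟨fun h => ?_, fun x hx => ?_⟩
      · have := (vst n hn _).2 (Or.inr rfl)
        rw [h, vsf n hn] at this
        exact h1 this.symm
      · by_cases h : ∃ y, y ∈ X ∧ R y x ∧ ap π (op n y) = ap π (op n f)
        · left
          refine ext fun z => ?_
          rw [vsX n hn x hx, vst n hn]
          grind
        · right
          refine ext fun z => ?_
          rw [vsX n hn x hx, vsf n hn]
          grind
  refine ⟨sep (prod omg X) fun p => ∃ n, n ∈ (omg : M) ∧ ∃ x, x ∈ X ∧ p = op n x ∧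
    ap π (op n x) = ap π (op n t), ?_, ?_⟩
  all_goals
    have hW : ∀ {n x}, n ∈ (omg : M) → x ∈ X → (op n x ∈ (sep (prod omg X) fun p => ∃ n,
      n ∈ (omg : M) ∧ ∃ x, x ∈ X ∧ p = op n x ∧ ap π (op n x) = ap π (op n t)) ↔
        ap π (op n x) = ap π (op n t)) := by
      intro n x hn hx
      simp only [mem_sep, op_mem_prod, op_inj]
      grind
  · intro x hx
    rw [hW emp_mem_omg hx]
    exact fun h => (key emp emp_mem_omg).1 (h.symm.trans ((v0 x (hXZ hx)
      (by rintro rfl; exact htX hx)).trans (v0 f hfZ ht0).symm))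
  · intro n hn x hx
    rw [hW (sc_mem_omg hn) hx]
    obtain ⟨h1, h2⟩ := key n hn
    constructor
    · intro h
      have := (vst n hn _).2 (Or.inr rfl)
      rw [← h, vsX n hn x hx] at this
      obtain h | ⟨y, hy, hyx, h⟩ := this
      · exact absurd h.symm h1
      · refine ⟨y, hy, hyx, ?_⟩
        rw [hW hn hy, ← h]
        exact h1.symm
    · rintro ⟨y, hy, hyx, h⟩
      rw [hW hn hy] at h
      refine ext fun z => ?_
      rw [vsX n hn x hx, vst n hn]
      have := h2 y hy
      grind

end

section

variable {M : Type} [setLang.Structure M] [CModel M] {n : ℕ}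

/-! ## Codes of formulas -/

/-- The von Neumann numerals. -/
noncomputable def num : ℕ → M
  | 0 => emp
  | k + 1 => sc (num k)

theorem isNum_iff {k : ℕ} : ∀ {x : M}, IsNum k x ↔ x = num k := by
  induction k with
  | zero =>
    exact fun {x} => ⟨fun h => ext fun u => by simp [num, h u], fun h u => by simp [h, num]⟩
  | succ k ih => intro x; simp [IsNum, ih, isSucc_iff, num]

@[simp] theorem num_inj {k l : ℕ} : (num k : M) = num l ↔ k = l := by
  induction k generalizing l with
  | zero => cases l <;> simp [num]
  | succ k ih => cases l <;> simp [num, ih]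

theorem num_mem_omg (k : ℕ) : (num k : M) ∈ (omg : M) := by
  induction k with
  | zero => exact emp_mem_omg
  | succ k ih => exact sc_mem_omg ih

/-- The triple `⟨k, x, y⟩`. -/
noncomputable def code (k : ℕ) (x y : M) : M := op (num k) (op x y)

/-- The code of the negation of `x`. -/
noncomputable def neg (x : M) : M := op (num 4) x

instance Tm.code (k : ℕ) (f g : (Fin n → M) → M) [Tm f] [Tm g] :
    Tm (fun v => code k (f v) (g v)) := by
  unfold WeakSet.code; infer_instance

instance Tm.neg (f : (Fin n → M) → M) [Tm f] : Tm (fun v => neg (f v)) := by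
  unfold WeakSet.neg; infer_instance

@[simp] theorem code_inj {k l : ℕ} {x y u v : M} :
    code k x y = code l u v ↔ k = l ∧ x = u ∧ y = v := by simp [code]

@[simp] theorem neg_inj {x y : M} : neg x = neg y ↔ x = y := by simp [neg]

theorem code_eq_neg {k : ℕ} {x y z : M} : code k x y = neg z ↔ k = 4 ∧ op x y = z := by
  simp [neg, code]

theorem neg_eq_code {k : ℕ} {x y z : M} : neg z = code k x y ↔ 4 = k ∧ z = op x y := by
  simp [neg, code]

theorem isCode_iff {k : ℕ} {c x y : M} : IsCode k c x y ↔ c = code k x y := by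
  simp [IsCode, isNum_iff, isOpair_iff, code]

theorem code_mem_VV {k : ℕ} {x y : M} (hx : x ∈ (VV : M)) (hy : y ∈ (VV : M)) :
    code k x y ∈ (VV : M) :=
  op_mem_VV (mem_VV_of_mem_omg _ (num_mem_omg k)) (op_mem_VV hx hy)

theorem neg_mem_VV {x : M} (hx : x ∈ (VV : M)) : neg x ∈ (VV : M) :=
  op_mem_VV (mem_VV_of_mem_omg _ (num_mem_omg 4)) hx

/-- `c` is the code of an atomic formula. -/
def Atomic (c : M) : Prop :=
  ∃ i, i ∈ (omg : M) ∧ ∃ j, j ∈ (omg : M) ∧ (c = code 0 i j ∨ c = code 1 i j)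

/-- `c` is the code of a formula with immediate subformulas `p` and possibly `q`. -/
def Compound (c p q : M) : Prop :=
  c = code 2 p q ∨ c = code 3 p q ∨ c = neg p ∨
    ∃ i, i ∈ (omg : M) ∧ (c = code 5 i p ∨ c = code 6 i p)

instance D0.atomic (f : (Fin n → M) → M) [Tm f] : D0 (fun v => Atomic (f v)) := by
  unfold Atomic; infer_instance

instance D0.compound (f g h : (Fin n → M) → M) [Tm f] [Tm g] [Tm h] :
    D0 (fun v => Compound (f v) (g v) (h v)) := by
  unfold Compound; infer_instance

/-- The set of codes of formulas. -/
noncomputable def Form : M := fixp VV Atomic Compound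

theorem mem_Form {c : M} : c ∈ (Form : M) ↔
    Atomic c ∨ ∃ p, p ∈ (Form : M) ∧ ∃ q, q ∈ (Form : M) ∧ Compound c p q := by
  rw [Form, mem_fixp, and_iff_right_iff_imp]
  have hV : ∀ p, p ∈ fixp VV Atomic Compound → p ∈ (VV : M) := fun p hp => (mem_fixp.1 hp).1
  rintro (⟨i, hi, j, hj, rfl | rfl⟩ | ⟨p, hp, q, hq, rfl | rfl | rfl | ⟨i, hi, rfl | rfl⟩⟩)
  · exact code_mem_VV (mem_VV_of_mem_omg _ hi) (mem_VV_of_mem_omg _ hj)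
  · exact code_mem_VV (mem_VV_of_mem_omg _ hi) (mem_VV_of_mem_omg _ hj)
  · exact code_mem_VV (hV p hp) (hV q hq)
  · exact code_mem_VV (hV p hp) (hV q hq)
  · exact neg_mem_VV (hV p hp)
  · exact code_mem_VV (mem_VV_of_mem_omg _ hi) (hV p hp)
  · exact code_mem_VV (mem_VV_of_mem_omg _ hi) (hV p hp)

/-- Regularity for the relation of being a component of a pair or triple. -/
theorem exists_minimal_components {Z y : M} (hZ : ∀ z, z ∈ Z → z ∈ (VV : M)) (hy : y ∈ Z) :
    ∃ z, z ∈ Z ∧ (∀ t p, z = op t p → ¬ p ∈ Z) ∧ ∀ t p q, z = op t (op p q) → ¬ p ∈ Z ∧ ¬ q ∈ Z := by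
  -- The entries p, q of ⟨t, ⟨p, q⟩⟩ lie four ∈-steps below it. An ∈-minimal `w` among the sets that
  -- reach `Z` in at most three steps must itself be in `Z`, and nothing one to four steps below it
  -- is. Transitivity of `VV` keeps the members of `w` within the bound.
  obtain ⟨w, hw, hm⟩ := regularity' (sep VV fun w => w ∈ Z ∨ ∃ a, a ∈ w ∧ (a ∈ Z ∨
    ∃ b, b ∈ a ∧ (b ∈ Z ∨ ∃ d, d ∈ b ∧ d ∈ Z))) (y := y) (mem_sep.2 ⟨hZ y hy, Or.inl hy⟩)
  obtain ⟨hwV, hw⟩ := mem_sep.1 hw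
  have hm' : ∀ a, a ∈ w → ¬ (a ∈ Z ∨ ∃ b, b ∈ a ∧ (b ∈ Z ∨
      ∃ d, d ∈ b ∧ (d ∈ Z ∨ ∃ e, e ∈ d ∧ e ∈ Z))) :=
    fun a ha h => hm a (mem_sep.2 ⟨VV_trans hwV ha, h⟩) ha
  have hop : ∀ x y : M, ∃ p, p ∈ op x y ∧ x ∈ p ∧ y ∈ p := fun x y => ⟨pr x y, by simp [op]⟩
  refine ⟨w, by grind, ?_, ?_⟩
  · rintro t p rfl hp
    have := hop t p
    grind
  · rintro t p q rfl
    obtain ⟨a, ha, -, ha'⟩ := hop t (op p q)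
    obtain ⟨b, hb, h1, h2⟩ := hop p q
    have := hm' a ha
    grind

/-- A derivation `S` of a formula outside `G` would have a component-minimal element outside `G`;
its immediate subformulas lie in `S`, hence in `G`, and closure gives a contradiction. This also
disposes of circular derivations. -/
theorem Form_least {G : M} (h0 : ∀ c, Atomic c → c ∈ G)
    (h1 : ∀ p, p ∈ G → ∀ q, q ∈ G → ∀ c, Compound c p q → c ∈ G) :
    ∀ c, c ∈ (Form : M) → c ∈ G := by
  intro c hc
  by_contra hcG
  obtain ⟨-, S, hS, hcS, hD⟩ := mem_fixp'.1 hc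
  obtain ⟨z, hz, hz1, hz2⟩ := exists_minimal_components (Z := sep S fun y => ¬ y ∈ G)
    (fun z hz => sub_of_mem_Pf hS (mem_sep.1 hz).1) (mem_sep.2 ⟨hcS, hcG⟩)
  obtain ⟨hzS, hzG⟩ := mem_sep.1 hz
  have hG : ∀ {p}, p ∈ S → ¬ p ∈ (sep S fun y => ¬ y ∈ G) → p ∈ G := fun hp h => by
    by_contra h'; exact h (mem_sep.2 ⟨hp, h'⟩)
  rcases hD z hzS with h | ⟨p, hp, q, hq, h⟩
  · exact hzG (h0 z h)
  · rcases h with h | h | h | ⟨i, hi, h | h⟩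
    · exact hzG (h1 p (hG hp (hz2 _ _ _ h).1) q (hG hq (hz2 _ _ _ h).2) z (Or.inl h))
    · exact hzG (h1 p (hG hp (hz2 _ _ _ h).1) q (hG hq (hz2 _ _ _ h).2) z (Or.inr (Or.inl h)))
    · have := hG hp (hz1 _ _ h)
      exact hzG (h1 p this p this z (Or.inr (Or.inr (Or.inl h))))
    · have := hG hp (hz2 _ _ _ h).2
      exact hzG (h1 p this p this z (Or.inr (Or.inr (Or.inr ⟨i, hi, Or.inl h⟩))))
    · have := hG hp (hz2 _ _ _ h).2
      exact hzG (h1 p this p this z (Or.inr (Or.inr (Or.inr ⟨i, hi, Or.inr h⟩))))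

theorem atom_mem_Form {i j : M} (hi : i ∈ (omg : M)) (hj : j ∈ (omg : M)) :
    code 0 i j ∈ (Form : M) ∧ code 1 i j ∈ (Form : M) :=
  ⟨mem_Form.2 (Or.inl ⟨i, hi, j, hj, Or.inl rfl⟩), mem_Form.2 (Or.inl ⟨i, hi, j, hj, Or.inr rfl⟩)⟩

theorem bin_mem_Form {p q : M} (hp : p ∈ (Form : M)) (hq : q ∈ (Form : M)) :
    code 2 p q ∈ (Form : M) ∧ code 3 p q ∈ (Form : M) :=
  ⟨mem_Form.2 (Or.inr ⟨p, hp, q, hq, Or.inl rfl⟩),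
    mem_Form.2 (Or.inr ⟨p, hp, q, hq, Or.inr (Or.inl rfl)⟩)⟩

theorem neg_mem_Form {p : M} (hp : p ∈ (Form : M)) : neg p ∈ (Form : M) :=
  mem_Form.2 (Or.inr ⟨p, hp, p, hp, Or.inr (Or.inr (Or.inl rfl))⟩)

theorem quant_mem_Form {i p : M} (hi : i ∈ (omg : M)) (hp : p ∈ (Form : M)) :
    code 5 i p ∈ (Form : M) ∧ code 6 i p ∈ (Form : M) :=
  ⟨mem_Form.2 (Or.inr ⟨p, hp, p, hp, Or.inr (Or.inr (Or.inr ⟨i, hi, Or.inl rfl⟩))⟩),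
    mem_Form.2 (Or.inr ⟨p, hp, p, hp, Or.inr (Or.inr (Or.inr ⟨i, hi, Or.inr rfl⟩))⟩)⟩

theorem of_atom_mem_Form {i j : M} (h : code 0 i j ∈ (Form : M) ∨ code 1 i j ∈ (Form : M)) :
    i ∈ (omg : M) ∧ j ∈ (omg : M) := by
  rcases h with h | h <;> rw [mem_Form] at h <;>
    simpa [Atomic, Compound, code_eq_neg] using h

theorem of_bin_mem_Form {p q : M} (h : code 2 p q ∈ (Form : M) ∨ code 3 p q ∈ (Form : M)) :
    p ∈ (Form : M) ∧ q ∈ (Form : M) := by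
  rcases h with h | h <;> rw [mem_Form] at h <;>
    simpa [Atomic, Compound, code_eq_neg] using h

theorem of_neg_mem_Form {p : M} (h : neg p ∈ (Form : M)) : p ∈ (Form : M) := by
  rw [mem_Form] at h
  simp [Atomic, Compound, neg_eq_code] at h
  exact h.1

theorem of_quant_mem_Form {i p : M} (h : code 5 i p ∈ (Form : M) ∨ code 6 i p ∈ (Form : M)) :
    i ∈ (omg : M) ∧ p ∈ (Form : M) := by
  rcases h with h | h <;> rw [mem_Form] at h <;>
    simp [Atomic, Compound, code_eq_neg] at h <;> grind

theorem Form_induction {P : M → Prop} [D0 (fun v : Fin 1 → M => P (v 0))]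
    (hm : ∀ i, i ∈ (omg : M) → ∀ j, j ∈ (omg : M) → P (code 0 i j))
    (he : ∀ i, i ∈ (omg : M) → ∀ j, j ∈ (omg : M) → P (code 1 i j))
    (ha : ∀ p, p ∈ (Form : M) → ∀ q, q ∈ (Form : M) → P p → P q → P (code 2 p q))
    (ho : ∀ p, p ∈ (Form : M) → ∀ q, q ∈ (Form : M) → P p → P q → P (code 3 p q))
    (hn : ∀ p, p ∈ (Form : M) → P p → P (neg p))
    (hex : ∀ i, i ∈ (omg : M) → ∀ p, p ∈ (Form : M) → P p → P (code 5 i p))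
    (hall : ∀ i, i ∈ (omg : M) → ∀ p, p ∈ (Form : M) → P p → P (code 6 i p)) :
    ∀ c, c ∈ (Form : M) → P c := by
  intro c hc
  refine (mem_sep.1 (Form_least (G := sep Form P) ?_ ?_ c hc)).2
  · rintro c ⟨i, hi, j, hj, rfl | rfl⟩
    · exact mem_sep.2 ⟨(atom_mem_Form hi hj).1, hm i hi j hj⟩
    · exact mem_sep.2 ⟨(atom_mem_Form hi hj).2, he i hi j hj⟩
  · intro p hp q hq c h
    obtain ⟨hp, hPp⟩ := mem_sep.1 hp
    obtain ⟨hq, hPq⟩ := mem_sep.1 hq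
    rcases h with rfl | rfl | rfl | ⟨i, hi, rfl | rfl⟩
    · exact mem_sep.2 ⟨(bin_mem_Form hp hq).1, ha p hp q hq hPp hPq⟩
    · exact mem_sep.2 ⟨(bin_mem_Form hp hq).2, ho p hp q hq hPp hPq⟩
    · exact mem_sep.2 ⟨neg_mem_Form hp, hn p hp hPp⟩
    · exact mem_sep.2 ⟨(quant_mem_Form hi hp).1, hex i hi p hp hPp⟩
    · exact mem_sep.2 ⟨(quant_mem_Form hi hp).2, hall i hi p hp hPp⟩

/-- `G` contains the atomic formulas and is closed under the logical operations. -/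
def FormClosed (G : M) : Prop :=
  (((∀ i j c, (IsNat i ∧ IsNat j) ∧ (c = code 0 i j ∨ c = code 1 i j) → c ∈ G) ∧
    (∀ p q c, (p ∈ G ∧ q ∈ G) ∧ (c = code 2 p q ∨ c = code 3 p q) → c ∈ G)) ∧
    (∀ p c, p ∈ G ∧ c = neg p → c ∈ G)) ∧
    ∀ i p c, (IsNat i ∧ p ∈ G) ∧ (c = code 5 i p ∨ c = code 6 i p) → c ∈ G

@[simp] theorem realize_negCode {e : Empty → M} {xs : Fin n → M} {c x : Fin n} :
    (negCode c x).Realize e xs ↔ xs c = neg (xs x) := by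
  simp [negCode, isNum_iff, isOpair_iff, neg]

theorem realize_formClosedF {e : Empty → M} {xs : Fin n → M} {F : Fin n} :
    (formClosedF F).Realize e xs ↔ FormClosed (xs F) := by
  simp only [formClosedF, FormClosed, realize_allF, realize_imp, realize_inf, realize_sup,
    realize_natF, realize_memF, realize_codeF, realize_negCode, isCode_iff, Fin.snoc_last,
    Fin.snoc_castSucc]

theorem formClosed_Form : FormClosed (Form : M) := by
  refine ⟨⟨⟨?_, ?_⟩, ?_⟩, ?_⟩
  · rintro i j c ⟨⟨hi, hj⟩, rfl | rfl⟩
    · exact (atom_mem_Form (mem_omg.2 hi) (mem_omg.2 hj)).1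
    · exact (atom_mem_Form (mem_omg.2 hi) (mem_omg.2 hj)).2
  · rintro p q c ⟨⟨hp, hq⟩, rfl | rfl⟩
    · exact (bin_mem_Form hp hq).1
    · exact (bin_mem_Form hp hq).2
  · rintro p c ⟨hp, rfl⟩
    exact neg_mem_Form hp
  · rintro i p c ⟨⟨hi, hp⟩, rfl | rfl⟩
    · exact (quant_mem_Form (mem_omg.2 hi) hp).1
    · exact (quant_mem_Form (mem_omg.2 hi) hp).2

theorem sub_of_formClosed {G : M} (h : FormClosed G) : Sub Form G := by
  obtain ⟨⟨⟨h1, h2⟩, h3⟩, h4⟩ := h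
  refine Form_least ?_ ?_
  · rintro c ⟨i, hi, j, hj, h⟩
    exact h1 i j c ⟨⟨mem_omg.1 hi, mem_omg.1 hj⟩, h⟩
  · rintro p hp q hq c (h | h | h | ⟨i, hi, h⟩)
    · exact h2 p q c ⟨⟨hp, hq⟩, Or.inl h⟩
    · exact h2 p q c ⟨⟨hp, hq⟩, Or.inr h⟩
    · exact h3 p c ⟨hp, h⟩
    · exact h4 i p c ⟨⟨mem_omg.1 hi, hp⟩, h⟩

@[simp] theorem realize_formF {e : Empty → M} {xs : Fin n → M} {F : Fin n} :
    (formF F).Realize e xs ↔ xs F = Form := by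
  simp only [formF, realize_inf, realize_allF, realize_imp, realize_formClosedF, realize_subF,
    Fin.snoc_last, Fin.snoc_castSucc]
  constructor
  · rintro ⟨h1, h2⟩
    exact ext fun u => ⟨h2 _ formClosed_Form u, sub_of_formClosed h1 u⟩
  · rintro h
    rw [h]
    exact ⟨formClosed_Form, fun G => sub_of_formClosed⟩

/-! ## Free variables -/

/-- The initial elements of the relation `k ∈ FV(c)`. -/
def FreeAtom (x : M) : Prop := ∃ i, i ∈ (omg : M) ∧ ∃ j, j ∈ (omg : M) ∧ ∃ k, k ∈ (omg : M) ∧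
  (x = op (code 0 i j) k ∨ x = op (code 1 i j) k) ∧ (k = i ∨ k = j)

/-- The closure conditions of the relation `k ∈ FV(c)`. -/
def FreeStep (x y : M) : Prop := ∃ p, p ∈ (Form : M) ∧ ∃ q, q ∈ (Form : M) ∧
  ∃ k, k ∈ (omg : M) ∧ y = op p k ∧
    (x = op (code 2 p q) k ∨ x = op (code 2 q p) k ∨ x = op (code 3 p q) k ∨
      x = op (code 3 q p) k ∨ x = op (neg p) k ∨
      ∃ i, i ∈ (omg : M) ∧ ¬ k = i ∧ (x = op (code 5 i p) k ∨ x = op (code 6 i p) k))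

instance D0.freeAtom (f : (Fin n → M) → M) [Tm f] : D0 (fun v => FreeAtom (f v)) := by
  unfold FreeAtom; infer_instance

instance D0.freeStep (f g : (Fin n → M) → M) [Tm f] [Tm g] :
    D0 (fun v => FreeStep (f v) (g v)) := by
  unfold FreeStep; infer_instance

/-- The set of pairs `⟨c, k⟩` with `k ∈ FV(c)`. -/
noncomputable def FV : M := fixp (prod Form omg) FreeAtom fun x y _ => FreeStep x y

theorem mem_FV {x : M} : x ∈ (FV : M) ↔ x ∈ prod (Form : M) omg ∧
    (FreeAtom x ∨ ∃ y, y ∈ (FV : M) ∧ FreeStep x y) := by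
  rw [FV, mem_fixp]; grind

theorem mem_FV_atom {i j k : M} (hi : i ∈ (omg : M)) (hj : j ∈ (omg : M)) (hk : k ∈ (omg : M)) :
    (op (code 0 i j) k ∈ (FV : M) ↔ k = i ∨ k = j) ∧
    (op (code 1 i j) k ∈ (FV : M) ↔ k = i ∨ k = j) := by
  simp [mem_FV (x := op _ k), hi, hj, hk, atom_mem_Form, FreeAtom, FreeStep, code_eq_neg]

theorem mem_FV_bin {p q k : M} (hp : p ∈ (Form : M)) (hq : q ∈ (Form : M)) (hk : k ∈ (omg : M)) :
    (op (code 2 p q) k ∈ (FV : M) ↔ op p k ∈ (FV : M) ∨ op q k ∈ (FV : M)) ∧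
    (op (code 3 p q) k ∈ (FV : M) ↔ op p k ∈ (FV : M) ∨ op q k ∈ (FV : M)) := by
  constructor <;> rw [mem_FV] <;>
    simp [hp, hq, hk, bin_mem_Form, FreeAtom, FreeStep, code_eq_neg] <;> grind

theorem mem_FV_neg {p k : M} (hp : p ∈ (Form : M)) (hk : k ∈ (omg : M)) :
    op (neg p) k ∈ (FV : M) ↔ op p k ∈ (FV : M) := by
  rw [mem_FV]
  simp [hp, hk, neg_mem_Form, FreeAtom, FreeStep, neg_eq_code]
  grind

theorem mem_FV_quant {i p k : M} (hi : i ∈ (omg : M)) (hp : p ∈ (Form : M)) (hk : k ∈ (omg : M)) :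
    (op (code 5 i p) k ∈ (FV : M) ↔ op p k ∈ (FV : M) ∧ ¬ k = i) ∧
    (op (code 6 i p) k ∈ (FV : M) ↔ op p k ∈ (FV : M) ∧ ¬ k = i) := by
  constructor <;> rw [mem_FV] <;>
    simp [hp, hi, hk, quant_mem_Form, FreeAtom, FreeStep, code_eq_neg] <;> grind

/-- `V` satisfies the recursive clauses for the set of free variables of formulas in `F`. -/
def FreeVar (V F : M) : Prop :=
  (∀ p, p ∈ V → ∃ c k, (c ∈ F ∧ IsNat k) ∧ p = op c k) ∧
  ∀ c k, c ∈ F ∧ IsNat k →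
    ((((∀ i j, c = code 0 i j ∨ c = code 1 i j → (op c k ∈ V ↔ k = i ∨ k = j)) ∧
      (∀ p q, c = code 2 p q ∨ c = code 3 p q → (op c k ∈ V ↔ op p k ∈ V ∨ op q k ∈ V))) ∧
      (∀ p, c = neg p → (op c k ∈ V ↔ op p k ∈ V))) ∧
      ∀ i p, c = code 5 i p ∨ c = code 6 i p → (op c k ∈ V ↔ op p k ∈ V ∧ ¬ k = i))

theorem realize_freeVarF {e : Empty → M} {xs : Fin n → M} {V F : Fin n} :
    (freeVarF V F).Realize e xs ↔ FreeVar (xs V) (xs F) := by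
  simp only [freeVarF, FreeVar, realize_allF, realize_exF, realize_imp, realize_inf, realize_sup,
    realize_iff, realize_not, realize_eqF, realize_opairF, realize_pairMemF,
    realize_natF, realize_memF, realize_codeF, realize_negCode, isCode_iff, isOpair_iff,
    pairMem_iff, Fin.snoc_last, Fin.snoc_castSucc]

theorem freeVar_FV : FreeVar (FV : M) Form := by
  refine ⟨fun p hp => ?_, ?_⟩
  · obtain ⟨c, hc, k, hk, rfl⟩ := mem_prod.1 (mem_FV.1 hp).1
    exact ⟨c, k, ⟨hc, mem_omg.1 hk⟩, rfl⟩
  · rintro c k ⟨hc, hk⟩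
    rw [← mem_omg] at hk
    refine ⟨⟨⟨?_, ?_⟩, ?_⟩, ?_⟩
    · rintro i j (rfl | rfl)
      · have h := of_atom_mem_Form (Or.inl hc)
        exact (mem_FV_atom h.1 h.2 hk).1
      · have h := of_atom_mem_Form (Or.inr hc)
        exact (mem_FV_atom h.1 h.2 hk).2
    · rintro p q (rfl | rfl)
      · have h := of_bin_mem_Form (Or.inl hc)
        exact (mem_FV_bin h.1 h.2 hk).1
      · have h := of_bin_mem_Form (Or.inr hc)
        exact (mem_FV_bin h.1 h.2 hk).2
    · rintro p rfl
      exact mem_FV_neg (of_neg_mem_Form hc) hk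
    · rintro i p (rfl | rfl)
      · have h := of_quant_mem_Form (Or.inl hc)
        exact (mem_FV_quant h.1 h.2 hk).1
      · have h := of_quant_mem_Form (Or.inr hc)
        exact (mem_FV_quant h.1 h.2 hk).2

/-- The recursive clauses determine the relation, by induction on formulas; so the witness
quantified in `diagramF` has to be `FV`. -/
theorem freeVar_iff {V : M} : FreeVar V Form ↔ V = FV := by
  refine ⟨fun h => ?_, fun h => h ▸ freeVar_FV⟩
  obtain ⟨h1, h2⟩ := h
  obtain ⟨h1', h2'⟩ := freeVar_FV (M := M)
  have key : ∀ c, c ∈ (Form : M) → ∀ k, k ∈ (omg : M) → (op c k ∈ V ↔ op c k ∈ (FV : M)) := by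
    apply Form_induction
    · intro i hi j hj k hk
      have hc := (atom_mem_Form hi hj).1
      rw [(h2 _ k ⟨hc, mem_omg.1 hk⟩).1.1.1 i j (Or.inl rfl), (mem_FV_atom hi hj hk).1]
    · intro i hi j hj k hk
      have hc := (atom_mem_Form hi hj).2
      rw [(h2 _ k ⟨hc, mem_omg.1 hk⟩).1.1.1 i j (Or.inr rfl), (mem_FV_atom hi hj hk).2]
    · intro p hp q hq h3 h4 k hk
      have hc := (bin_mem_Form hp hq).1
      rw [(h2 _ k ⟨hc, mem_omg.1 hk⟩).1.1.2 p q (Or.inl rfl), (mem_FV_bin hp hq hk).1, h3 k hk,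
        h4 k hk]
    · intro p hp q hq h3 h4 k hk
      have hc := (bin_mem_Form hp hq).2
      rw [(h2 _ k ⟨hc, mem_omg.1 hk⟩).1.1.2 p q (Or.inr rfl), (mem_FV_bin hp hq hk).2, h3 k hk,
        h4 k hk]
    · intro p hp h3 k hk
      rw [(h2 _ k ⟨neg_mem_Form hp, mem_omg.1 hk⟩).1.2 p rfl, mem_FV_neg hp hk, h3 k hk]
    · intro i hi p hp h3 k hk
      have hc := (quant_mem_Form hi hp).1
      rw [(h2 _ k ⟨hc, mem_omg.1 hk⟩).2 i p (Or.inl rfl), (mem_FV_quant hi hp hk).1, h3 k hk]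
    · intro i hi p hp h3 k hk
      have hc := (quant_mem_Form hi hp).2
      rw [(h2 _ k ⟨hc, mem_omg.1 hk⟩).2 i p (Or.inr rfl), (mem_FV_quant hi hp hk).2, h3 k hk]
  refine ext fun u => ⟨fun hu => ?_, fun hu => ?_⟩
  · obtain ⟨c, k, ⟨hc, hk⟩, rfl⟩ := h1 u hu
    exact (key c hc k (mem_omg.2 hk)).1 hu
  · obtain ⟨c, k, ⟨hc, hk⟩, rfl⟩ := h1' u hu
    exact (key c hc k (mem_omg.2 hk)).2 hu

end

section

variable {M : Type} [setLang.Structure M] [CModel M] {n : ℕ}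

/-! ## Finite sequences -/

/-- Finite sequences are finite sets of pairs, so Finite Powerset bounds them by a set. The
induction is on initial segments. -/
theorem mem_Pf_of_fun {l a σ : M} (hl : l ∈ (omg : M)) (h : Fun σ l a) : σ ∈ Pf (prod omg a) := by
  have key : ∀ j, j ∈ (omg : M) → Sub j l →
      sep σ (fun p => ∃ m, m ∈ j ∧ ∃ y, y ∈ a ∧ p = op m y) ∈ Pf (prod omg a) := by
    refine omg_induction (fun _ => ?_) fun j hj ih hjl => ?_
    · rw [show sep σ (fun p => ∃ m, m ∈ emp ∧ ∃ y, y ∈ a ∧ p = op m y) = emp from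
        ext fun u => by simp]
      exact emp_mem_Pf
    · have hjl' : j ∈ l := hjl j (by simp)
      have h1 := h.ap_mem hjl'
      rw [show sep σ (fun p => ∃ m, m ∈ sc j ∧ ∃ y, y ∈ a ∧ p = op m y) =
          ins (sep σ fun p => ∃ m, m ∈ j ∧ ∃ y, y ∈ a ∧ p = op m y) (op j (ap σ j)) from
        ext fun u => by
          rw [mem_sep, mem_ins, mem_sep]
          simp only [mem_sc]
          constructor
          · rintro ⟨hu, m, hm | rfl, y, hy, rfl⟩
            · exact Or.inl ⟨hu, m, hm, y, hy, rfl⟩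
            · rw [(h.mem_iff.1 hu).2]; exact Or.inr rfl
          · rintro (⟨hu, m, hm, y, hy, rfl⟩ | rfl)
            · exact ⟨hu, m, Or.inl hm, y, hy, rfl⟩
            · exact ⟨h1.1, j, Or.inr rfl, _, h1.2, rfl⟩]
      exact ins_mem_Pf (ih fun u hu => hjl u (by simp [hu])) (by simp [hj, h1.2])
  have := key l hl fun u hu => hu
  rwa [show sep σ (fun p => ∃ m, m ∈ l ∧ ∃ y, y ∈ a ∧ p = op m y) = σ from ext fun u => by
    rw [mem_sep, and_iff_left_iff_imp]
    exact (fun_iff.1 h).1 u] at this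

/-- The set of finite sequences of elements of `a`. -/
noncomputable def Seq (a : M) : M := sep (Pf (prod omg a)) fun σ => ∃ l, l ∈ (omg : M) ∧ Fun σ l a

theorem mem_Seq {a σ : M} : σ ∈ Seq a ↔ ∃ l, l ∈ (omg : M) ∧ Fun σ l a := by
  rw [Seq, mem_sep, and_iff_right_iff_imp]
  rintro ⟨l, hl, h⟩
  exact mem_Pf_of_fun hl h

theorem mem_of_mem_Seq {a σ i u : M} (h : σ ∈ Seq a) (hi : op i u ∈ σ) :
    i ∈ (omg : M) ∧ u ∈ a := by
  obtain ⟨l, hl, h⟩ := mem_Seq.1 h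
  obtain ⟨h1, rfl⟩ := h.mem_iff.1 hi
  exact ⟨mem_omg_of_mem hl h1, (h.ap_mem h1).2⟩

/-- `σ[b/x_i]`. -/
noncomputable def upd (a σ i b : M) : M := sep (prod omg a) fun p =>
  ∃ j, j ∈ (omg : M) ∧ ∃ u, u ∈ a ∧ p = op j u ∧ ((op j u ∈ σ ∧ ¬ j = i) ∨
    (u = b ∧ (j = i ∨ (j ∈ i ∧ ¬ ∃ w, w ∈ a ∧ op j w ∈ σ))))

instance Tm.upd (a : M) (f g h : (Fin n → M) → M) [Tm f] [Tm g] [Tm h] :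
    Tm (fun v => upd a (f v) (g v) (h v)) := by
  unfold WeakSet.upd; infer_instance

theorem mem_upd {a σ i b j u : M} : op j u ∈ upd a σ i b ↔ (j ∈ (omg : M) ∧ u ∈ a) ∧
    ((op j u ∈ σ ∧ ¬ j = i) ∨ (u = b ∧ (j = i ∨ (j ∈ i ∧ ¬ ∃ w, w ∈ a ∧ op j w ∈ σ)))) := by
  simp only [upd, mem_sep, op_mem_prod, op_inj]
  grind

theorem upd_mem_Seq {a σ i b : M} (h : σ ∈ Seq a) (hi : i ∈ (omg : M)) (hb : b ∈ a) :
    upd a σ i b ∈ Seq a := by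
  obtain ⟨l, hl, h⟩ := mem_Seq.1 h
  refine mem_Seq.2 ⟨un l (sc i), un_mem_omg hl (sc_mem_omg hi), fun_iff.2 ⟨fun p hp => ?_, ?_⟩⟩
  · obtain ⟨j, hj, u, hu, rfl⟩ := mem_prod.1 (mem_sep.1 hp).1
    refine ⟨j, ?_, u, hu, rfl⟩
    rcases (mem_upd.1 hp).2 with ⟨h1, _⟩ | ⟨_, h1 | ⟨h1, _⟩⟩
    · simp [(h.mem_iff.1 h1).1]
    · simp [h1]
    · simp [h1]
  · intro j hj
    have hj' := mem_omg_of_mem (un_mem_omg hl (sc_mem_omg hi)) hj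
    simp only [mem_upd, h.mem_iff]
    by_cases hji : j = i
    · exact ⟨b, hb, by grind⟩
    · by_cases hjl : j ∈ l
      · have := (h.ap_mem hjl).2
        exact ⟨ap σ j, this, by grind⟩
      · have : j ∈ i := by simp at hj; grind
        exact ⟨b, hb, by grind⟩

/-- `τ = σ[b/x_i]`. -/
def IsUpd (τ σ i b : M) : Prop := ∀ p, p ∈ τ ↔ ∃ j u, p = op j u ∧ ((op j u ∈ σ ∧ ¬ j = i) ∨
  (u = b ∧ (j = i ∨ (j ∈ i ∧ ¬ ∃ w, op j w ∈ σ))))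

theorem realize_updateF {e : Empty → M} {xs : Fin n → M} {τ σ i b : Fin n} :
    (updateF τ σ i b).Realize e xs ↔ IsUpd (xs τ) (xs σ) (xs i) (xs b) := by
  simp only [updateF, IsUpd, realize_allF, realize_exF, realize_inf, realize_sup,
    realize_iff, realize_not, realize_eqF, realize_opairF, realize_pairMemF, realize_memF,
    isOpair_iff, pairMem_iff, Fin.snoc_last, Fin.snoc_castSucc]

theorem isUpd_iff {a τ σ i b : M} (h : σ ∈ Seq a) (hi : i ∈ (omg : M)) (hb : b ∈ a) :
    IsUpd τ σ i b ↔ τ = upd a σ i b := by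
  have h' : IsUpd (upd a σ i b) σ i b := by
    have hσ := fun {j u} => mem_of_mem_Seq (i := j) (u := u) h
    intro p
    constructor
    · intro hp
      obtain ⟨j, hj, u, hu, rfl⟩ := mem_prod.1 (mem_sep.1 hp).1
      refine ⟨j, u, rfl, ?_⟩
      rw [mem_upd] at hp
      grind
    · rintro ⟨j, u, rfl, h1⟩
      have hij : j ∈ i → j ∈ (omg : M) := mem_omg_of_mem hi
      rw [mem_upd]
      grind
  exact ⟨fun h1 => ext fun p => by rw [h1 p, h' p], fun h1 => h1 ▸ h'⟩

/-- `σ` is a finite sequence in `a` that assigns values to all free variables of `c`. -/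
def Assigns (a c σ : M) : Prop :=
  σ ∈ Seq a ∧ ∀ i, i ∈ (omg : M) → op c i ∈ (FV : M) → ∃ u, u ∈ a ∧ op i u ∈ σ

instance D0.assigns (a : M) (f g : (Fin n → M) → M) [Tm f] [Tm g] :
    D0 (fun v => Assigns a (f v) (g v)) := by
  unfold Assigns; infer_instance

/-- The domain of a sequence is its length, so exceeding an index means having a value there; stated
that way, the length disappears and the condition is visibly Δ₀. -/
theorem realize_assignF {e : Empty → M} {xs : Fin n → M} {a V c σ : Fin n} (hV : xs V = FV) :
    (assignF a V c σ).Realize e xs ↔ Assigns (xs a) (xs c) (xs σ) := by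
  simp only [assignF, realize_allF, realize_exF, realize_inf, realize_imp, realize_natF,
    realize_funF, realize_pairMemF, realize_memF, pairMem_iff, Fin.snoc_last, Fin.snoc_castSucc,
    hV, ← mem_omg]
  constructor
  · rintro ⟨l, ⟨hl, h⟩, h1⟩
    refine ⟨mem_Seq.2 ⟨l, hl, h⟩, fun i _ hi => ?_⟩
    have := h.ap_mem (h1 i hi)
    exact ⟨_, this.2, this.1⟩
  · rintro ⟨h, h1⟩
    obtain ⟨l, hl, h⟩ := mem_Seq.1 h
    refine ⟨l, ⟨hl, h⟩, fun i hi => ?_⟩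
    obtain ⟨u, hu, hiu⟩ := h1 i (op_mem_prod.1 (mem_FV.1 hi).1).2 hi
    exact (h.mem_iff.1 hiu).1

theorem Assigns.bin {a p q σ : M} (hp : p ∈ (Form : M)) (hq : q ∈ (Form : M))
    (h : Assigns a (code 2 p q) σ ∨ Assigns a (code 3 p q) σ) : Assigns a p σ ∧ Assigns a q σ := by
  have := fun k hk => mem_FV_bin (k := k) hp hq hk
  unfold Assigns at *
  grind

theorem Assigns.neg {a p σ : M} (hp : p ∈ (Form : M)) (h : Assigns a (neg p) σ) :
    Assigns a p σ := by
  have := fun k hk => mem_FV_neg (k := k) hp hk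
  unfold Assigns at *
  grind

/-- A free variable of `p` other than `i` is free in the quantified formula, so already has a value,
and the update leaves it alone. -/
theorem Assigns.quant {a i p σ b : M} (hi : i ∈ (omg : M)) (hp : p ∈ (Form : M)) (hb : b ∈ a)
    (h : Assigns a (code 5 i p) σ ∨ Assigns a (code 6 i p) σ) : Assigns a p (upd a σ i b) := by
  have h1 := fun k hk => mem_FV_quant (k := k) hi hp hk
  have hσ : σ ∈ Seq a := by rcases h with h | h <;> exact h.1
  refine ⟨upd_mem_Seq hσ hi hb, fun k hk hkp => ?_⟩
  simp only [mem_upd]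
  by_cases hki : k = i
  · exact ⟨b, hb, by grind⟩
  · unfold Assigns at h
    grind

/-! ## Truth definitions -/

/-- `H` satisfies the Tarski conditions for `(a, ∈)`, at the pairs in `G`. -/
structure Tarski (a : M) (G : M → M → Prop) (H : M) : Prop where
  mem : ∀ i, i ∈ (omg : M) → ∀ j, j ∈ (omg : M) → ∀ σ, σ ∈ Seq a → G (code 0 i j) σ →
    (op (code 0 i j) σ ∈ H ↔ ∃ u, u ∈ a ∧ ∃ v, v ∈ a ∧ op i u ∈ σ ∧ op j v ∈ σ ∧ u ∈ v)
  eq : ∀ i, i ∈ (omg : M) → ∀ j, j ∈ (omg : M) → ∀ σ, σ ∈ Seq a → G (code 1 i j) σ →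
    (op (code 1 i j) σ ∈ H ↔ ∃ u, u ∈ a ∧ ∃ v, v ∈ a ∧ op i u ∈ σ ∧ op j v ∈ σ ∧ u = v)
  and : ∀ p, p ∈ (Form : M) → ∀ q, q ∈ (Form : M) → ∀ σ, σ ∈ Seq a → G (code 2 p q) σ →
    (op (code 2 p q) σ ∈ H ↔ op p σ ∈ H ∧ op q σ ∈ H)
  or : ∀ p, p ∈ (Form : M) → ∀ q, q ∈ (Form : M) → ∀ σ, σ ∈ Seq a → G (code 3 p q) σ →
    (op (code 3 p q) σ ∈ H ↔ op p σ ∈ H ∨ op q σ ∈ H)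
  neg : ∀ p, p ∈ (Form : M) → ∀ σ, σ ∈ Seq a → G (neg p) σ →
    (op (WeakSet.neg p) σ ∈ H ↔ ¬ op p σ ∈ H)
  ex : ∀ i, i ∈ (omg : M) → ∀ p, p ∈ (Form : M) → ∀ σ, σ ∈ Seq a → G (code 5 i p) σ →
    (op (code 5 i p) σ ∈ H ↔ ∃ b, b ∈ a ∧ op p (upd a σ i b) ∈ H)
  all : ∀ i, i ∈ (omg : M) → ∀ p, p ∈ (Form : M) → ∀ σ, σ ∈ Seq a → G (code 6 i p) σ →
    (op (code 6 i p) σ ∈ H ↔ ∀ b, b ∈ a → op p (upd a σ i b) ∈ H)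

/-- The moves of the evaluation game for `(a, ∈)`. -/
def Move (a y x : M) : Prop :=
  (∃ i, i ∈ (omg : M) ∧ ∃ j, j ∈ (omg : M) ∧ ∃ σ, σ ∈ Seq a ∧ y = emp ∧
    ((x = op (code 0 i j) σ ∧ ∃ u, u ∈ a ∧ ∃ v, v ∈ a ∧ op i u ∈ σ ∧ op j v ∈ σ ∧ u ∈ v) ∨
      (x = op (code 1 i j) σ ∧ ∃ u, u ∈ a ∧ ∃ v, v ∈ a ∧ op i u ∈ σ ∧ op j v ∈ σ ∧ u = v))) ∨
  ∃ p, p ∈ (Form : M) ∧ ∃ σ, σ ∈ Seq a ∧ ((x = op (neg p) σ ∧ y = op p σ) ∨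
    (∃ q, q ∈ (Form : M) ∧ ((x = op (code 2 p q) σ ∧ y = op (code 3 (neg p) (neg q)) σ) ∨
      (x = op (code 3 p q) σ ∧ (y = op (neg p) σ ∨ y = op (neg q) σ)))) ∨
    ∃ i, i ∈ (omg : M) ∧
      ((x = op (code 5 i p) σ ∧ ∃ b, b ∈ a ∧ y = op (neg p) (upd a σ i b)) ∨
        (x = op (code 6 i p) σ ∧ y = op (code 5 i (neg p)) σ)))

set_option synthInstance.maxHeartbeats 200000 in
set_option synthInstance.maxSize 2000 in
instance D0.move (a : M) (f g : (Fin n → M) → M) [Tm f] [Tm g] :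
    D0 (fun v => Move a (f v) (g v)) := by
  unfold Move; infer_instance

@[simp] theorem op_ne_emp {x y : M} : op x y ≠ emp := fun h =>
  not_mem_emp (x := pr x y) (by rw [← h]; simp [op])

@[simp] theorem emp_ne_op {x y : M} : emp ≠ op x y := op_ne_emp.symm

/-- `W` consists of the approximations to the set of won positions of the evaluation game. -/
structure Approx (a W : M) : Prop where
  mem : ∀ n, n ∈ (omg : M) → ∀ i, i ∈ (omg : M) → ∀ j, j ∈ (omg : M) → ∀ σ, σ ∈ Seq a →
    (op (sc n) (op (code 0 i j) σ) ∈ W ↔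
      ∃ u, u ∈ a ∧ ∃ v, v ∈ a ∧ op i u ∈ σ ∧ op j v ∈ σ ∧ u ∈ v)
  eq : ∀ n, n ∈ (omg : M) → ∀ i, i ∈ (omg : M) → ∀ j, j ∈ (omg : M) → ∀ σ, σ ∈ Seq a →
    (op (sc n) (op (code 1 i j) σ) ∈ W ↔
      ∃ u, u ∈ a ∧ ∃ v, v ∈ a ∧ op i u ∈ σ ∧ op j v ∈ σ ∧ u = v)
  neg : ∀ n, n ∈ (omg : M) → ∀ p, p ∈ (Form : M) → ∀ σ, σ ∈ Seq a →
    (op (sc n) (op (neg p) σ) ∈ W ↔ ¬ op n (op p σ) ∈ W)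
  or : ∀ n, n ∈ (omg : M) → ∀ p, p ∈ (Form : M) → ∀ q, q ∈ (Form : M) → ∀ σ, σ ∈ Seq a →
    (op (sc (sc n)) (op (code 3 p q) σ) ∈ W ↔ op n (op p σ) ∈ W ∨ op n (op q σ) ∈ W)
  and : ∀ n, n ∈ (omg : M) → ∀ p, p ∈ (Form : M) → ∀ q, q ∈ (Form : M) → ∀ σ, σ ∈ Seq a →
    (op (sc (sc (sc (sc n)))) (op (code 2 p q) σ) ∈ W ↔ op n (op p σ) ∈ W ∧ op n (op q σ) ∈ W)
  ex : ∀ n, n ∈ (omg : M) → ∀ i, i ∈ (omg : M) → ∀ p, p ∈ (Form : M) → ∀ σ, σ ∈ Seq a →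
    (op (sc (sc n)) (op (code 5 i p) σ) ∈ W ↔ ∃ b, b ∈ a ∧ op n (op p (upd a σ i b)) ∈ W)
  all : ∀ n, n ∈ (omg : M) → ∀ i, i ∈ (omg : M) → ∀ p, p ∈ (Form : M) → ∀ σ, σ ∈ Seq a →
    (op (sc (sc (sc (sc n)))) (op (code 6 i p) σ) ∈ W ↔
      ∀ b, b ∈ a → op n (op p (upd a σ i b)) ∈ W)

/-- A position is won when some move leads to a position not won. The dead position ∅ is never won,
and exactly the true atoms may move to it. A negation moves to the negated formula, a disjunction to
the negations of its disjuncts, an existential formula to the negations of its instances;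
conjunction and ∀ move to the formula that De Morgan's laws negate. Each move costs one level,
whence the shifts by 1, 2 and 4. -/
theorem exists_approx (a : M) : ∃ W : M, Approx a W := by
  -- The extra position ∅ differs from every pair.
  obtain ⟨W, h0, hs⟩ := exists_levels (ins (prod Form (Seq a)) emp) (Move a)
  have hemp : ∀ n, n ∈ (omg : M) → ¬ op n emp ∈ W := by
    intro n hn
    rcases omg_cases hn with rfl | ⟨m, hm, rfl⟩
    · exact h0 emp (by simp)
    · rw [hs m hm emp (by simp)]
      simp [Move]
  have hs' : ∀ n, n ∈ (omg : M) → ∀ c, c ∈ (Form : M) → ∀ σ, σ ∈ Seq a →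
      (op (sc n) (op c σ) ∈ W ↔ (Move a emp (op c σ)) ∨ ∃ d, d ∈ (Form : M) ∧ ∃ τ, τ ∈ Seq a ∧
        Move a (op d τ) (op c σ) ∧ ¬ op n (op d τ) ∈ W) := by
    intro n hn c hc σ hσ
    rw [hs n hn _ (by simp [hc, hσ])]
    constructor
    · rintro ⟨y, hy, h1, h2⟩
      rcases mem_ins.1 hy with hy | rfl
      · obtain ⟨d, hd, τ, hτ, rfl⟩ := mem_prod.1 hy
        exact Or.inr ⟨d, hd, τ, hτ, h1, h2⟩
      · exact Or.inl h1
    · rintro (h | ⟨d, hd, τ, hτ, h1, h2⟩)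
      · exact ⟨emp, by simp, h, hemp n hn⟩
      · exact ⟨op d τ, by simp [hd, hτ], h1, h2⟩
  have hneg : ∀ n, n ∈ (omg : M) → ∀ p, p ∈ (Form : M) → ∀ σ, σ ∈ Seq a →
      (op (sc n) (op (neg p) σ) ∈ W ↔ ¬ op n (op p σ) ∈ W) := by
    intro n hn p hp σ hσ
    rw [hs' n hn _ (neg_mem_Form hp) σ hσ]
    simp [Move, neg_eq_code]
    grind
  have hor : ∀ n, n ∈ (omg : M) → ∀ p, p ∈ (Form : M) → ∀ q, q ∈ (Form : M) → ∀ σ, σ ∈ Seq a →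
      (op (sc (sc n)) (op (code 3 p q) σ) ∈ W ↔ op n (op p σ) ∈ W ∨ op n (op q σ) ∈ W) := by
    intro n hn p hp q hq σ hσ
    have h1 := hneg n hn p hp σ hσ
    have h2 := hneg n hn q hq σ hσ
    have := neg_mem_Form hp
    have := neg_mem_Form hq
    rw [hs' _ (sc_mem_omg hn) _ (bin_mem_Form hp hq).2 σ hσ]
    simp [Move, code_eq_neg]
    grind
  have hex : ∀ n, n ∈ (omg : M) → ∀ i, i ∈ (omg : M) → ∀ p, p ∈ (Form : M) → ∀ σ, σ ∈ Seq a →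
      (op (sc (sc n)) (op (code 5 i p) σ) ∈ W ↔
        ∃ b, b ∈ a ∧ op n (op p (upd a σ i b)) ∈ W) := by
    intro n hn i hi p hp σ hσ
    have h1 := fun b hb => hneg n hn p hp (upd a σ i b) (upd_mem_Seq hσ hi hb)
    have h2 := fun b hb => upd_mem_Seq (b := b) hσ hi hb
    have := neg_mem_Form hp
    rw [hs' _ (sc_mem_omg hn) _ (quant_mem_Form hi hp).1 σ hσ]
    clear hs hs' hneg hor
    simp [Move, code_eq_neg]
    grind
  refine ⟨W, ⟨?_, ?_, hneg, hor, ?_, hex, ?_⟩⟩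
  · intro n hn i hi j hj σ hσ
    rw [hs' n hn _ (atom_mem_Form hi hj).1 σ hσ]
    simp [Move, code_eq_neg]
    grind
  · intro n hn i hi j hj σ hσ
    rw [hs' n hn _ (atom_mem_Form hi hj).2 σ hσ]
    simp [Move, code_eq_neg]
    grind
  · intro n hn p hp q hq σ hσ
    have hn1 := sc_mem_omg hn
    have hp' := neg_mem_Form hp
    have hq' := neg_mem_Form hq
    -- Four levels: one for the move to the disjunction of negations, two for the disjunction, one
    -- for each negation.
    have h1 := hor _ hn1 _ hp' _ hq' σ hσ
    rw [hneg n hn p hp σ hσ, hneg n hn q hq σ hσ] at h1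
    have h2 := (bin_mem_Form hp' hq').2
    rw [hs' _ (sc_mem_omg (sc_mem_omg hn1)) _ (bin_mem_Form hp hq).1 σ hσ]
    clear hs hs' hneg hor hex
    simp [Move, code_eq_neg]
    grind
  · intro n hn i hi p hp σ hσ
    have hn1 := sc_mem_omg hn
    have hp' := neg_mem_Form hp
    have h1 := hex _ hn1 i hi _ hp' σ hσ
    have h0 := fun b hb => hneg n hn p hp (upd a σ i b) (upd_mem_Seq hσ hi hb)
    have h2 := (quant_mem_Form hi hp').1
    rw [hs' _ (sc_mem_omg (sc_mem_omg hn1)) _ (quant_mem_Form hi hp).2 σ hσ]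
    clear hs hs' hneg hor hex
    simp [Move, code_eq_neg]
    grind

/-! ### Stabilization of the approximations -/

theorem exists_eq_sc_of_sub {n m : M} (hm : m ∈ (omg : M))
    (h : Sub (sc n) m) : ∃ k, k ∈ (omg : M) ∧ m = sc k ∧ Sub n k := by
  have hnm := h n (by simp)
  rcases omg_cases hm with rfl | ⟨k, hk, rfl⟩
  · exact absurd hnm not_mem_emp
  · refine ⟨k, hk, rfl, ?_⟩
    rcases mem_sc.1 hnm with h1 | rfl
    · exact sub_of_mem_omg hk h1
    · exact fun u hu => hu

theorem exists_eq_sc_sc_of_sub {n m : M} (hm : m ∈ (omg : M))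
    (h : Sub (sc (sc n)) m) : ∃ k, k ∈ (omg : M) ∧ m = sc (sc k) ∧ Sub n k := by
  obtain ⟨k, hk, rfl, h1⟩ := exists_eq_sc_of_sub hm h
  obtain ⟨l, hl, rfl, h2⟩ := exists_eq_sc_of_sub hk h1
  exact ⟨l, hl, rfl, h2⟩

/-- From level `n` on, the approximations do not change at the formula `c`. -/
def Stable (a W n c : M) : Prop := ∀ m, m ∈ (omg : M) → Sub n m → ∀ σ, σ ∈ Seq a →
  (op m (op c σ) ∈ W ↔ op n (op c σ) ∈ W)

instance D0.stable (a W : M) (f g : (Fin n → M) → M) [Tm f] [Tm g] :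
    D0 (fun v => Stable a W (f v) (g v)) := by
  unfold Stable; infer_instance

theorem Stable.mono {a W n m c : M} (h : Stable a W n c) (hm : m ∈ (omg : M)) (hnm : Sub n m) :
    Stable a W m c := fun k hk hmk σ hσ => by
  rw [h k hk (fun u hu => hmk u (hnm u hu)) σ hσ, h m hm hnm σ hσ]

/-- Each connective or quantifier shifts the stabilization level by a constant, after passing to the
larger level when there are two subformulas. The level is uniform in the assignment, which is what
the quantifier cases need. Stability is Δ₀ because ω and `Seq a` are sets. -/
theorem Approx.exists_stable {a W : M} (h : Approx a W) :
    ∀ c, c ∈ (Form : M) → ∃ n, n ∈ (omg : M) ∧ Stable a W n c := by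
  have two : ∀ {p q n n' : M}, n ∈ (omg : M) → n' ∈ (omg : M) → Stable a W n p →
      Stable a W n' q → ∃ k, k ∈ (omg : M) ∧ Stable a W k p ∧ Stable a W k q :=
    fun {p q n n'} hn hn' h h' => ⟨un n n', un_mem_omg hn hn',
      h.mono (un_mem_omg hn hn') fun u hu => by simp [hu],
      h'.mono (un_mem_omg hn hn') fun u hu => by simp [hu]⟩
  apply Form_induction
  · intro i hi j hj
    refine ⟨sc emp, sc_mem_omg emp_mem_omg, fun m hm hnm σ hσ => ?_⟩
    obtain ⟨k, hk, rfl, -⟩ := exists_eq_sc_of_sub hm hnm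
    rw [h.mem k hk i hi j hj σ hσ, h.mem _ emp_mem_omg i hi j hj σ hσ]
  · intro i hi j hj
    refine ⟨sc emp, sc_mem_omg emp_mem_omg, fun m hm hnm σ hσ => ?_⟩
    obtain ⟨k, hk, rfl, -⟩ := exists_eq_sc_of_sub hm hnm
    rw [h.eq k hk i hi j hj σ hσ, h.eq _ emp_mem_omg i hi j hj σ hσ]
  · rintro p hp q hq ⟨n, hn, h1⟩ ⟨n', hn', h2⟩
    obtain ⟨n, hn, h1, h2⟩ := two hn hn' h1 h2
    have hn1 := sc_mem_omg hn
    have hn2 := sc_mem_omg hn1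
    refine ⟨_, sc_mem_omg (sc_mem_omg hn2), fun m hm hnm σ hσ => ?_⟩
    obtain ⟨k, hk, rfl, hnk⟩ := exists_eq_sc_sc_of_sub hm hnm
    obtain ⟨l, hl, rfl, hnl⟩ := exists_eq_sc_sc_of_sub hk hnk
    rw [h.and l hl p hp q hq σ hσ, h.and n hn p hp q hq σ hσ, h1 l hl hnl σ hσ, h2 l hl hnl σ hσ]
  · rintro p hp q hq ⟨n, hn, h1⟩ ⟨n', hn', h2⟩
    obtain ⟨n, hn, h1, h2⟩ := two hn hn' h1 h2
    have hn1 := sc_mem_omg hn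
    refine ⟨_, sc_mem_omg hn1, fun m hm hnm σ hσ => ?_⟩
    obtain ⟨l, hl, rfl, hnl⟩ := exists_eq_sc_sc_of_sub hm hnm
    rw [h.or l hl p hp q hq σ hσ, h.or n hn p hp q hq σ hσ, h1 l hl hnl σ hσ, h2 l hl hnl σ hσ]
  · rintro p hp ⟨n, hn, h1⟩
    refine ⟨_, sc_mem_omg hn, fun m hm hnm σ hσ => ?_⟩
    obtain ⟨l, hl, rfl, hnl⟩ := exists_eq_sc_of_sub hm hnm
    rw [h.neg l hl p hp σ hσ, h.neg n hn p hp σ hσ, h1 l hl hnl σ hσ]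
  · rintro i hi p hp ⟨n, hn, h1⟩
    have hn1 := sc_mem_omg hn
    refine ⟨_, sc_mem_omg hn1, fun m hm hnm σ hσ => ?_⟩
    obtain ⟨l, hl, rfl, hnl⟩ := exists_eq_sc_sc_of_sub hm hnm
    rw [h.ex l hl i hi p hp σ hσ, h.ex n hn i hi p hp σ hσ]
    exact exists_congr fun b => and_congr_right fun hb => h1 l hl hnl _ (upd_mem_Seq hσ hi hb)
  · rintro i hi p hp ⟨n, hn, h1⟩
    have hn1 := sc_mem_omg hn
    have hn2 := sc_mem_omg hn1
    refine ⟨_, sc_mem_omg (sc_mem_omg hn2), fun m hm hnm σ hσ => ?_⟩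
    obtain ⟨k, hk, rfl, hnk⟩ := exists_eq_sc_sc_of_sub hm hnm
    obtain ⟨l, hl, rfl, hnl⟩ := exists_eq_sc_sc_of_sub hk hnk
    rw [h.all l hl i hi p hp σ hσ, h.all n hn i hi p hp σ hσ]
    exact forall_congr' fun b => imp_congr_right fun hb => h1 l hl hnl _ (upd_mem_Seq hσ hi hb)

/-- Truth is being won at all sufficiently late levels. No bound on the stabilization levels over
all formulas is needed: each clause is checked at one level late enough for the formula and its
immediate subformulas, where `Approx` gives the Tarski condition. -/
theorem exists_truth (a : M) : ∃ T : M, Tarski a (fun _ _ => True) T := by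
  obtain ⟨W, h⟩ := exists_approx a
  let T : M := sep (prod Form (Seq a)) fun x =>
    ∃ n, n ∈ (omg : M) ∧ ∀ m, m ∈ (omg : M) → Sub n m → op m x ∈ W
  have hT : ∀ c, c ∈ (Form : M) → ∃ n, n ∈ (omg : M) ∧ ∀ m, m ∈ (omg : M) → Sub n m →
      ∀ σ, σ ∈ Seq a → (op c σ ∈ T ↔ op m (op c σ) ∈ W) := by
    intro c hc
    obtain ⟨n, hn, h1⟩ := h.exists_stable c hc
    refine ⟨n, hn, fun m hm hnm σ hσ => ?_⟩
    simp only [T, mem_sep, op_mem_prod, hc, hσ, true_and]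
    constructor
    · rintro ⟨k, hk, h2⟩
      have h3 := h2 _ (un_mem_omg hk hn) fun u hu => by simp [hu]
      rwa [h1 _ (un_mem_omg hk hn) (fun u hu => by simp [hu]) σ hσ, ← h1 m hm hnm σ hσ] at h3
    · intro h2
      rw [h1 m hm hnm σ hσ] at h2
      exact ⟨n, hn, fun k hk hnk => (h1 k hk hnk σ hσ).2 h2⟩
  have three : ∀ p, p ∈ (Form : M) → ∀ q, q ∈ (Form : M) → ∀ c, c ∈ (Form : M) →
      ∃ n, n ∈ (omg : M) ∧ (∀ σ, σ ∈ Seq a → (op p σ ∈ T ↔ op n (op p σ) ∈ W)) ∧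
      (∀ σ, σ ∈ Seq a → (op q σ ∈ T ↔ op n (op q σ) ∈ W)) ∧
      ∀ m, m ∈ (omg : M) → Sub n m → ∀ σ, σ ∈ Seq a → (op c σ ∈ T ↔ op m (op c σ) ∈ W) := by
    intro p hp q hq c hc
    obtain ⟨n1, hn1, h1⟩ := hT p hp
    obtain ⟨n2, hn2, h2⟩ := hT q hq
    obtain ⟨n3, hn3, h3⟩ := hT c hc
    have hn := un_mem_omg (un_mem_omg hn1 hn2) hn3
    exact ⟨_, hn, h1 _ hn fun u hu => by simp [hu], h2 _ hn fun u hu => by simp [hu],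
      fun m hm hnm => h3 m hm fun u hu => hnm u (by simp [hu])⟩
  have hsub1 : ∀ n : M, Sub n (sc n) := fun n u hu => by simp [hu]
  have hsub2 : ∀ n : M, Sub n (sc (sc n)) := fun n u hu => by simp [hu]
  have hsub4 : ∀ n : M, Sub n (sc (sc (sc (sc n)))) := fun n u hu => by simp [hu]
  refine ⟨T, ⟨?_, ?_, ?_, ?_, ?_, ?_, ?_⟩⟩
  · intro i hi j hj σ hσ _
    obtain ⟨n, hn, h1⟩ := hT _ (atom_mem_Form hi hj).1
    rw [h1 _ (sc_mem_omg hn) (hsub1 n) σ hσ, h.mem n hn i hi j hj σ hσ]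
  · intro i hi j hj σ hσ _
    obtain ⟨n, hn, h1⟩ := hT _ (atom_mem_Form hi hj).2
    rw [h1 _ (sc_mem_omg hn) (hsub1 n) σ hσ, h.eq n hn i hi j hj σ hσ]
  · intro p hp q hq σ hσ _
    obtain ⟨n, hn, h1, h2, h3⟩ := three p hp q hq _ (bin_mem_Form hp hq).1
    rw [h3 _ (sc_mem_omg (sc_mem_omg (sc_mem_omg (sc_mem_omg hn)))) (hsub4 n) σ hσ,
      h.and n hn p hp q hq σ hσ, h1 σ hσ, h2 σ hσ]
  · intro p hp q hq σ hσ _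
    obtain ⟨n, hn, h1, h2, h3⟩ := three p hp q hq _ (bin_mem_Form hp hq).2
    rw [h3 _ (sc_mem_omg (sc_mem_omg hn)) (hsub2 n) σ hσ,
      h.or n hn p hp q hq σ hσ, h1 σ hσ, h2 σ hσ]
  · intro p hp σ hσ _
    obtain ⟨n, hn, h1, -, h3⟩ := three p hp p hp _ (neg_mem_Form hp)
    rw [h3 _ (sc_mem_omg hn) (hsub1 n) σ hσ, h.neg n hn p hp σ hσ, h1 σ hσ]
  · intro i hi p hp σ hσ _
    obtain ⟨n, hn, h1, -, h3⟩ := three p hp p hp _ (quant_mem_Form hi hp).1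
    rw [h3 _ (sc_mem_omg (sc_mem_omg hn)) (hsub2 n) σ hσ, h.ex n hn i hi p hp σ hσ]
    exact exists_congr fun b => and_congr_right fun hb => (h1 _ (upd_mem_Seq hσ hi hb)).symm
  · intro i hi p hp σ hσ _
    obtain ⟨n, hn, h1, -, h3⟩ := three p hp p hp _ (quant_mem_Form hi hp).2
    rw [h3 _ (sc_mem_omg (sc_mem_omg (sc_mem_omg (sc_mem_omg hn)))) (hsub4 n) σ hσ,
      h.all n hn i hi p hp σ hσ]
    exact forall_congr' fun b => imp_congr_right fun hb => (h1 _ (upd_mem_Seq hσ hi hb)).symm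

/-! ## Elementary diagrams -/

/-- `H` is an elementary diagram of `(a, ∈)`. -/
def Diagram (a H : M) : Prop :=
  (∀ p, p ∈ H → ∃ c, c ∈ (Form : M) ∧ ∃ σ, Assigns a c σ ∧ p = op c σ) ∧ Tarski a (Assigns a) H

/-- Restricting truth to adequate assignments preserves the Tarski conditions, since subformulas
stay adequately assigned, after the update in the quantifier cases. -/
theorem exists_diagram (a : M) : ∃ H : M, Diagram a H := by
  obtain ⟨T, hT⟩ := exists_truth a
  let H : M := sep (prod Form (Seq a)) fun x => ∃ c, c ∈ (Form : M) ∧ ∃ σ, σ ∈ Seq a ∧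
    x = op c σ ∧ Assigns a c σ ∧ x ∈ T
  have hH : ∀ {c σ}, c ∈ (Form : M) → σ ∈ Seq a → Assigns a c σ → (op c σ ∈ H ↔ op c σ ∈ T) := by
    intro c σ hc hσ h
    simp only [H, mem_sep, op_mem_prod, op_inj]
    grind
  refine ⟨H, fun p hp => ?_, ⟨?_, ?_, ?_, ?_, ?_, ?_, ?_⟩⟩
  rotate_left 1
  · intro i hi j hj σ hσ h
    rw [hH (atom_mem_Form hi hj).1 hσ h, hT.mem i hi j hj σ hσ trivial]
  · intro i hi j hj σ hσ h
    rw [hH (atom_mem_Form hi hj).2 hσ h, hT.eq i hi j hj σ hσ trivial]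
  · intro p hp q hq σ hσ h
    have h' := Assigns.bin hp hq (Or.inl h)
    rw [hH (bin_mem_Form hp hq).1 hσ h, hT.and p hp q hq σ hσ trivial, hH hp hσ h'.1,
      hH hq hσ h'.2]
  · intro p hp q hq σ hσ h
    have h' := Assigns.bin hp hq (Or.inr h)
    rw [hH (bin_mem_Form hp hq).2 hσ h, hT.or p hp q hq σ hσ trivial, hH hp hσ h'.1,
      hH hq hσ h'.2]
  · intro p hp σ hσ h
    rw [hH (neg_mem_Form hp) hσ h, hT.neg p hp σ hσ trivial, hH hp hσ (h.neg hp)]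
  · intro i hi p hp σ hσ h
    rw [hH (quant_mem_Form hi hp).1 hσ h, hT.ex i hi p hp σ hσ trivial]
    exact exists_congr fun b => and_congr_right fun hb =>
      (hH hp (upd_mem_Seq hσ hi hb) (Assigns.quant hi hp hb (Or.inl h))).symm
  · intro i hi p hp σ hσ h
    rw [hH (quant_mem_Form hi hp).2 hσ h, hT.all i hi p hp σ hσ trivial]
    exact forall_congr' fun b => imp_congr_right fun hb =>
      (hH hp (upd_mem_Seq hσ hi hb) (Assigns.quant hi hp hb (Or.inr h))).symm
  · obtain ⟨-, c, hc, σ, hσ, rfl, h, -⟩ := mem_sep.1 hp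
    exact ⟨c, hc, σ, h, rfl⟩

theorem Diagram.unique {a H H' : M} (h : Diagram a H) (h' : Diagram a H') : H = H' := by
  have key : ∀ c, c ∈ (Form : M) → ∀ σ, σ ∈ Seq a → Assigns a c σ →
      (op c σ ∈ H ↔ op c σ ∈ H') := by
    obtain ⟨-, h⟩ := h
    obtain ⟨-, h'⟩ := h'
    apply Form_induction
    · intro i hi j hj σ hσ hs
      rw [h.mem i hi j hj σ hσ hs, h'.mem i hi j hj σ hσ hs]
    · intro i hi j hj σ hσ hs
      rw [h.eq i hi j hj σ hσ hs, h'.eq i hi j hj σ hσ hs]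
    · intro p hp q hq h1 h2 σ hσ hs
      have hs' := Assigns.bin hp hq (Or.inl hs)
      rw [h.and p hp q hq σ hσ hs, h'.and p hp q hq σ hσ hs, h1 σ hσ hs'.1, h2 σ hσ hs'.2]
    · intro p hp q hq h1 h2 σ hσ hs
      have hs' := Assigns.bin hp hq (Or.inr hs)
      rw [h.or p hp q hq σ hσ hs, h'.or p hp q hq σ hσ hs, h1 σ hσ hs'.1, h2 σ hσ hs'.2]
    · intro p hp h1 σ hσ hs
      rw [h.neg p hp σ hσ hs, h'.neg p hp σ hσ hs, h1 σ hσ (hs.neg hp)]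
    · intro i hi p hp h1 σ hσ hs
      rw [h.ex i hi p hp σ hσ hs, h'.ex i hi p hp σ hσ hs]
      exact exists_congr fun b => and_congr_right fun hb =>
        h1 _ (upd_mem_Seq hσ hi hb) (Assigns.quant hi hp hb (Or.inl hs))
    · intro i hi p hp h1 σ hσ hs
      rw [h.all i hi p hp σ hσ hs, h'.all i hi p hp σ hσ hs]
      exact forall_congr' fun b => imp_congr_right fun hb =>
        h1 _ (upd_mem_Seq hσ hi hb) (Assigns.quant hi hp hb (Or.inr hs))
  refine ext fun u => ⟨fun hu => ?_, fun hu => ?_⟩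
  · obtain ⟨c, hc, σ, hs, rfl⟩ := h.1 u hu
    exact (key c hc σ hs.1 hs).1 hu
  · obtain ⟨c, hc, σ, hs, rfl⟩ := h'.1 u hu
    exact (key c hc σ hs.1 hs).2 hu

/-! ### Agreement of the semantic diagram with the formula `diagramF` -/

/-- `H` satisfies the conditions for atomic formulas at `c` and `σ`. -/
def AtomicAt (H c σ : M) : Prop := ∀ i j,
  (c = code 0 i j → (op c σ ∈ H ↔ ∃ u v, (op i u ∈ σ ∧ op j v ∈ σ) ∧ u ∈ v)) ∧
  (c = code 1 i j → (op c σ ∈ H ↔ ∃ u v, (op i u ∈ σ ∧ op j v ∈ σ) ∧ u = v))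

/-- `H` satisfies the Tarski conditions at `c` and `σ`. -/
def TarskiAt (a H c σ : M) : Prop :=
  ((((∀ p q, c = code 2 p q → (op c σ ∈ H ↔ op p σ ∈ H ∧ op q σ ∈ H)) ∧
  (∀ p q, c = code 3 p q → (op c σ ∈ H ↔ op p σ ∈ H ∨ op q σ ∈ H))) ∧
  (∀ p, c = neg p → (op c σ ∈ H ↔ ¬ op p σ ∈ H))) ∧
  (∀ i p, c = code 5 i p → (op c σ ∈ H ↔ ∃ b, b ∈ a ∧ ∃ τ, IsUpd τ σ i b ∧ op p τ ∈ H))) ∧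
  (∀ i p, c = code 6 i p → (op c σ ∈ H ↔ ∀ b, b ∈ a → ∃ τ, IsUpd τ σ i b ∧ op p τ ∈ H))

theorem realize_atomicF {e : Empty → M} {xs : Fin n → M} {H c σ : Fin n} :
    (atomicF H c σ).Realize e xs ↔ AtomicAt (xs H) (xs c) (xs σ) := by
  simp only [atomicF, AtomicAt, realize_allF, realize_exF, realize_inf, realize_imp,
    realize_iff, realize_eqF, realize_pairMemF, realize_memF, realize_codeF, isCode_iff,
    pairMem_iff, Fin.snoc_last, Fin.snoc_castSucc]

theorem realize_tarskiF {e : Empty → M} {xs : Fin n → M} {a H c σ : Fin n} :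
    (tarskiF a H c σ).Realize e xs ↔ TarskiAt (xs a) (xs H) (xs c) (xs σ) := by
  simp only [tarskiF, TarskiAt, realize_allF, realize_exF, realize_inf, realize_sup, realize_imp,
    realize_not, realize_iff, realize_pairMemF, realize_memF, realize_codeF, realize_negCode,
    realize_updateF, isCode_iff, pairMem_iff, Fin.snoc_last, Fin.snoc_castSucc]

/-- The formulas quantify over all sets where `Tarski` uses bounded quantifiers. The bounds are
automatic: components of a code in `Form` are indices or formulas, and values of a sequence in `Seq
a` lie in `a`. -/
theorem tarski_iff {a H : M} : Tarski a (Assigns a) H ↔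
    ∀ c σ, c ∈ (Form : M) ∧ Assigns a c σ → AtomicAt H c σ ∧ TarskiAt a H c σ := by
  have hat : ∀ {σ i j}, σ ∈ Seq a → ∀ R : M → M → Prop,
      ((∃ u v, (op i u ∈ σ ∧ op j v ∈ σ) ∧ R u v) ↔
        ∃ u, u ∈ a ∧ ∃ v, v ∈ a ∧ op i u ∈ σ ∧ op j v ∈ σ ∧ R u v) := by
    intro σ i j hσ R
    have := fun {i u} => mem_of_mem_Seq (i := i) (u := u) hσ
    grind
  have hupd : ∀ {σ i b p}, σ ∈ Seq a → i ∈ (omg : M) → b ∈ a →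
      ((∃ τ, IsUpd τ σ i b ∧ op p τ ∈ H) ↔ op p (upd a σ i b) ∈ H) := by
    intro σ i b p hσ hi hb
    simp [isUpd_iff hσ hi hb]
  constructor
  · rintro h c σ ⟨hc, hs⟩
    have hσ := hs.1
    refine ⟨fun i j => ⟨?_, ?_⟩, ⟨⟨⟨?_, ?_⟩, ?_⟩, ?_⟩, ?_⟩
    · rintro rfl
      obtain ⟨hi, hj⟩ := of_atom_mem_Form (Or.inl hc)
      rw [hat hσ, h.mem i hi j hj σ hσ hs]
    · rintro rfl
      obtain ⟨hi, hj⟩ := of_atom_mem_Form (Or.inr hc)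
      rw [hat hσ, h.eq i hi j hj σ hσ hs]
    · rintro p q rfl
      obtain ⟨hp, hq⟩ := of_bin_mem_Form (Or.inl hc)
      exact h.and p hp q hq σ hσ hs
    · rintro p q rfl
      obtain ⟨hp, hq⟩ := of_bin_mem_Form (Or.inr hc)
      exact h.or p hp q hq σ hσ hs
    · rintro p rfl
      exact h.neg p (of_neg_mem_Form hc) σ hσ hs
    · rintro i p rfl
      obtain ⟨hi, hp⟩ := of_quant_mem_Form (Or.inl hc)
      rw [h.ex i hi p hp σ hσ hs]
      exact exists_congr fun b => and_congr_right fun hb => (hupd hσ hi hb).symm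
    · rintro i p rfl
      obtain ⟨hi, hp⟩ := of_quant_mem_Form (Or.inr hc)
      rw [h.all i hi p hp σ hσ hs]
      exact forall_congr' fun b => imp_congr_right fun hb => (hupd hσ hi hb).symm
  · intro h
    refine ⟨?_, ?_, ?_, ?_, ?_, ?_, ?_⟩
    · intro i hi j hj σ hσ hs
      rw [← hat hσ]
      exact ((h _ σ ⟨(atom_mem_Form hi hj).1, hs⟩).1 i j).1 rfl
    · intro i hi j hj σ hσ hs
      rw [← hat hσ]
      exact ((h _ σ ⟨(atom_mem_Form hi hj).2, hs⟩).1 i j).2 rfl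
    · intro p hp q hq σ hσ hs
      exact (h _ σ ⟨(bin_mem_Form hp hq).1, hs⟩).2.1.1.1.1 p q rfl
    · intro p hp q hq σ hσ hs
      exact (h _ σ ⟨(bin_mem_Form hp hq).2, hs⟩).2.1.1.1.2 p q rfl
    · intro p hp σ hσ hs
      exact (h _ σ ⟨neg_mem_Form hp, hs⟩).2.1.1.2 p rfl
    · intro i hi p hp σ hσ hs
      rw [(h _ σ ⟨(quant_mem_Form hi hp).1, hs⟩).2.1.2 i p rfl]
      exact exists_congr fun b => and_congr_right fun hb => hupd hσ hi hb
    · intro i hi p hp σ hσ hs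
      rw [(h _ σ ⟨(quant_mem_Form hi hp).2, hs⟩).2.2 i p rfl]
      exact forall_congr' fun b => imp_congr_right fun hb => hupd hσ hi hb

/-- The existential witnesses are forced to be `Form` and `FV`, so they can be eliminated. -/
theorem realize_diagramF {e : Empty → M} {xs : Fin n → M} {a H : Fin n} :
    (diagramF a H).Realize e xs ↔ Diagram (xs a) (xs H) := by
  simp only [diagramF, realize_allF, realize_exF, realize_inf, realize_imp, realize_memF,
    realize_formF, realize_freeVarF, realize_atomicF, realize_tarskiF, realize_opairF, isOpair_iff,
    Fin.snoc_last, Fin.snoc_castSucc]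
  constructor
  · rintro ⟨F, V, ⟨⟨rfl, hV⟩, h1⟩, h2⟩
    obtain rfl := freeVar_iff.1 hV
    refine ⟨fun p hp => ?_, tarski_iff.2 fun c σ h => h2 c σ ⟨h.1, ?_⟩⟩
    · obtain ⟨c, σ, ⟨hc, hs⟩, rfl⟩ := h1 p hp
      rw [realize_assignF (by simp)] at hs
      exact ⟨c, hc, σ, by simpa using hs, rfl⟩
    · rw [realize_assignF (by simp)]
      simpa using h.2
  · rintro ⟨h1, h2⟩
    refine ⟨Form, FV, ⟨⟨rfl, freeVar_FV⟩, fun p hp => ?_⟩, fun c σ h =>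
      tarski_iff.1 h2 c σ ⟨h.1, ?_⟩⟩
    · obtain ⟨c, hc, σ, hs, rfl⟩ := h1 p hp
      refine ⟨c, σ, ⟨hc, ?_⟩, rfl⟩
      rw [realize_assignF (by simp)]
      simpa using hs
    · have := h.2
      rw [realize_assignF (by simp)] at this
      simpa using this

end

end WeakSet

/-- The theory `C` proves that for every set `a` the elementary diagram `Th(a, ∈)` exists (and is
unique): this holds in every model of `C`. -/
theorem mainTheorem6 : WeakSet.theoryC ⊨ᵇ WeakSet.thExists := by
  rw [FirstOrder.Language.Theory.models_sentence_iff]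
  intro M
  have : WeakSet.CModel M := WeakSet.cModel_of_models M.is_model
  intro a
  obtain ⟨H, hH⟩ := WeakSet.exists_diagram (a : M)
  refine WeakSet.realize_exF.2 ⟨H, ?_⟩
  rw [FirstOrder.Language.BoundedFormula.realize_inf]
  simp only [WeakSet.realize_allF, FirstOrder.Language.BoundedFormula.realize_imp,
    WeakSet.realize_diagramF, WeakSet.realize_eqF, Fin.snoc_last, Fin.snoc_castSucc]
  exact ⟨hH, fun H' hH' => hH'.unique hH⟩
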